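/- Let $U:\mathbb R^q\times\mathbb R^d\to\mathbb R$, $(\xi,\theta)\mapsto U(\xi,\theta)$, be convex with $\int_{\mathbb R^q}e^{-U(\xi,\theta)}\,d\xi=1$ for all $\theta$, and let $\mathbb P_\theta$ be the probability measure on $\mathbb R^q$ with density $\pi_\theta=e^{-U(\cdot,\theta)}$. Write $|\cdot|$ for Euclidean norms and $\pi_\theta(f)=\int f\,d\mathbb P_\theta$. Consider the following assumptions. * **Prior.** $\pi_0=e^{-V_0}$ is a probability density on $\mathbb R^d$, where $V_0$ is convex and $C^1$, and $\nabla V_0$ is $1$-Lipschitz ($V_0\in\mathcal C^1_1$). * $(\mathbf{PI_U})$ There is $C_P^U>0$ such that $\mathrm{Var}_{\mathbb P_\theta}(f)\le C_P^U\,\pi_\theta(|\nabla f|^2)$ for all $\theta\in\mathbb R^d$ and all locally Lipschitz $f\in L^2(\mathbb P_\theta)$ (the right-hand side may be infinite). * $(\mathbf A_L)$ $U$ is differentiable in $\theta$, and for all $\xi,\xi_1,\xi_2,\theta,\theta_1,\theta_2$ one has $|\nabla_\theta U(\xi,\theta_1)-\nabla_\theta U(\xi,\theta_2)|\le L|\theta_1-\theta_2|$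 and $|\nabla_\theta U(\xi_1,\theta)-\nabla_\theta U(\xi_2,\theta)|\le L|\xi_1-\xi_2|$. * $(\mathbf{I_{W_1}(c)})$ There are a strictly increasing $c:\mathbb R_+\to\mathbb R_+$ with $c(0)=0$, an integer $m$, and a $1$-Lipschitz map $\Psi:\mathbb R^q\to\mathbb R^m$ such that $|\pi_{\theta_1}(\Psi)-\pi_{\theta_2}(\Psi)|\ge c(|\theta_1-\theta_2|)$ for all $\theta_1,\theta_2\in\mathbb R^d$. Moreover, with $b_1,b_2,\alpha_c>0$, $$c(\Delta)\ \ge\ b_1\Delta^{\alpha_c}\mathbf 1_{\Delta\le1}+b_2(\log\Delta+1)\mathbf 1_{\Delta\ge1}\qquad\text{for all }\Delta\ge0.$$ Given i.i.d. observations $\xi^n=(\xi_1,\dots,\xi_n)$, let $$\pi_n(\theta)=\frac{\pi_0(\theta)e^{-\sum_{i=1}^nU(\xi_i,\theta)}}{\int_{\mathbb R^d}\pi_0(\vartheta)e^{-\sum_{i=1}^nU(\xi_i,\vartheta)}\,d\vartheta},\qquad \tilde\theta_n=\int_{\mathbb R^d}\theta\,\pi_n(\theta)\,d\theta,$$ be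 the posterior density and the posterior mean, and set $\varepsilon_n^2=(C_P^UL^2)^{1/\alpha_c}\left(\frac{d\log n}{n}\right)^{1/\alpha_c}$. **Theorem.** For all $p>1$, $b_1,b_2,L>0$ and $\kappa\in\mathbb R$ there is a constant $C=C(p,b_1,b_2,L,\kappa)>0$ such that the following holds for all $d$, $q$, all $n\ge2$, all $\alpha_c>0$ and $C_P^U>0$, and all $U$, $V_0$ satisfying the assumptions above with these constants. Let $\theta^\star\in\mathbb R^d$ with $V_0(\theta^\star)\le\kappa d$, and suppose that $b_1\varepsilon_n^{\alpha_c}\le1$. If $\xi_1,\dots,\xi_n$ are i.i.d. with law $\mathbb P_{\theta^\star}$, then $\tilde\theta_n$ is almost surely well defined (the normalizing constant is finite and positive, and $\pi_n$ has a finite first moment), and $$\Big(\mathbb E_{\theta^\star}\big[|\tilde\theta_n-\theta^\star|^p\big]\Big)^{1/p}\ \le\ C\,\big(\sqrt{C_P^U}\,L\big)^{1/\alpha_c}\left(\frac{d\log n}{n}\right)^{\frac1{2\alpha_c}} .$$ In particular, $C$ depends neither on $n,d,q,C_P^U,\alpha_c$ nor on the model beyond $b_1,b_2,L$, and it depends on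 the prior and on $\theta^\star$ only through an upper bound $\kappa$ for $V_0(\theta^\star)/d$. -/

import Mathlib

open MeasureTheory ProbabilityTheory
open scoped NNReal ENNReal

noncomputable section

/-- The model distribution `ℙ_θ` on `ℝ^q`, with Lebesgue density `π_θ(ξ) = exp (-U(ξ, θ))`. -/
def modelMeasure {q d : ℕ} (U : EuclideanSpace ℝ (Fin q) → EuclideanSpace ℝ (Fin d) → ℝ)
    (θ : EuclideanSpace ℝ (Fin d)) : Measure (EuclideanSpace ℝ (Fin q)) :=
  volume.withDensity fun ξ => ENNReal.ofReal (Real.exp (-U ξ θ))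

/-- Log-concave statistical model: `U` is jointly convex in `(ξ, θ)` and every `exp (-U(·, θ))` is a
probability density. -/
structure IsLogConcaveModel {q d : ℕ}
    (U : EuclideanSpace ℝ (Fin q) → EuclideanSpace ℝ (Fin d) → ℝ) : Prop where
  convex : ConvexOn ℝ Set.univ
    fun z : EuclideanSpace ℝ (Fin q) × EuclideanSpace ℝ (Fin d) => U z.1 z.2
  normalized : ∀ θ, ∫⁻ ξ, ENNReal.ofReal (Real.exp (-U ξ θ)) = 1

/-- Log-concave `C¹` prior density `exp (-V₀)` on `ℝ^d` with `V₀ ∈ C¹₁`, i.e. `∇V₀` is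
`1`-Lipschitz. -/
structure IsC11LogConcavePrior {d : ℕ} (V₀ : EuclideanSpace ℝ (Fin d) → ℝ) : Prop where
  convex : ConvexOn ℝ Set.univ V₀
  contDiff : ContDiff ℝ 1 V₀
  gradient_lipschitz : LipschitzWith 1 (gradient V₀)
  normalized : ∫⁻ θ, ENNReal.ofReal (Real.exp (-V₀ θ)) = 1

/-- `μ` satisfies a Poincaré inequality with constant `C`: `Var_μ(f) ≤ C μ(|∇f|²)` for the locally
Lipschitz `f ∈ L²(μ)`. Such an `f` is differentiable Lebesgue-almost everywhere (Rademacher), and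
`‖fderiv ℝ f x‖ = |∇f(x)|`; the right-hand side may be infinite. -/
def SatisfiesPoincare {q : ℕ} (μ : Measure (EuclideanSpace ℝ (Fin q))) (C : ℝ) : Prop :=
  ∀ f : EuclideanSpace ℝ (Fin q) → ℝ, LocallyLipschitz f → MemLp f 2 μ →
    evariance f μ ≤ ENNReal.ofReal C * ∫⁻ x, ‖fderiv ℝ f x‖ₑ ^ 2 ∂μ

/-- `(PI_U)`: all the `ℙ_θ` satisfy a Poincaré inequality with the same constant `CP`. -/
def UniformPoincare {q d : ℕ} (U : EuclideanSpace ℝ (Fin q) → EuclideanSpace ℝ (Fin d) → ℝ)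
    (CP : ℝ) : Prop :=
  ∀ θ, SatisfiesPoincare (modelMeasure U θ) CP

/-- `(A_L)`: `U` is differentiable in `θ`, and `∇_θ U` is `L`-Lipschitz in `θ` and in `ξ`. -/
structure SmoothModel {q d : ℕ} (U : EuclideanSpace ℝ (Fin q) → EuclideanSpace ℝ (Fin d) → ℝ)
    (L : ℝ) : Prop where
  differentiable : ∀ ξ, Differentiable ℝ (U ξ)
  lipschitz_param : ∀ ξ θ₁ θ₂,
    ‖gradient (U ξ) θ₁ - gradient (U ξ) θ₂‖ ≤ L * ‖θ₁ - θ₂‖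
  lipschitz_obs : ∀ ξ₁ ξ₂ θ,
    ‖gradient (U ξ₁) θ - gradient (U ξ₂) θ‖ ≤ L * ‖ξ₁ - ξ₂‖

/-- `(I_{W₁}(c))`, Wasserstein identifiability with constants `b₁, b₂` and exponent `α`. The
`1`-Lipschitz map `Ψ` takes values in some `ℝ^m`, as it does for location models, where it is the
identity of `ℝ^d` (a real-valued `Ψ` could separate the parameters only for `d ≤ 1`). -/
def WassersteinIdentifiable {q d : ℕ}
    (U : EuclideanSpace ℝ (Fin q) → EuclideanSpace ℝ (Fin d) → ℝ) (b₁ b₂ α : ℝ) : Prop :=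
  ∃ (c : ℝ≥0 → ℝ≥0) (m : ℕ) (Ψ : EuclideanSpace ℝ (Fin q) → EuclideanSpace ℝ (Fin m)),
    StrictMono c ∧ c 0 = 0 ∧ LipschitzWith 1 Ψ ∧
    (∀ θ₁ θ₂, (c (nndist θ₁ θ₂) : ℝ) ≤
      ‖(∫ ξ, Ψ ξ ∂(modelMeasure U θ₁)) - ∫ ξ, Ψ ξ ∂(modelMeasure U θ₂)‖) ∧
    (∀ Δ : ℝ≥0, (if Δ ≤ 1 then b₁ * (Δ : ℝ) ^ α else 0)
        + (if 1 ≤ Δ then b₂ * (Real.log Δ + 1) else 0) ≤ (c Δ : ℝ))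

/-- Law of `n` i.i.d. observations `(ξ_1, …, ξ_n)` drawn from `ℙ_θ`. -/
def dataLaw {q d : ℕ} (U : EuclideanSpace ℝ (Fin q) → EuclideanSpace ℝ (Fin d) → ℝ)
    (θ : EuclideanSpace ℝ (Fin d)) (n : ℕ) : Measure (Fin n → EuclideanSpace ℝ (Fin q)) :=
  Measure.pi fun _ => modelMeasure U θ

/-- Unnormalized posterior density `π₀(θ) exp (-W_n(ξ, θ))`, where `W_n(ξ, θ) = ∑ U(ξ_i, θ)`. -/
def posteriorWeight {q d n : ℕ} (U : EuclideanSpace ℝ (Fin q) → EuclideanSpace ℝ (Fin d) → ℝ)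
    (V₀ : EuclideanSpace ℝ (Fin d) → ℝ) (ξ : Fin n → EuclideanSpace ℝ (Fin q))
    (θ : EuclideanSpace ℝ (Fin d)) : ℝ :=
  Real.exp (-V₀ θ) * Real.exp (-∑ i, U (ξ i) θ)

/-- Normalizing constant `Z_n(ξ)` of the posterior. -/
def posteriorNorm {q d n : ℕ} (U : EuclideanSpace ℝ (Fin q) → EuclideanSpace ℝ (Fin d) → ℝ)
    (V₀ : EuclideanSpace ℝ (Fin d) → ℝ) (ξ : Fin n → EuclideanSpace ℝ (Fin q)) : ℝ :=
  ∫ θ, posteriorWeight U V₀ ξ θ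

/-- Posterior density `π_n`. -/
def posteriorDensity {q d n : ℕ} (U : EuclideanSpace ℝ (Fin q) → EuclideanSpace ℝ (Fin d) → ℝ)
    (V₀ : EuclideanSpace ℝ (Fin d) → ℝ) (ξ : Fin n → EuclideanSpace ℝ (Fin q))
    (θ : EuclideanSpace ℝ (Fin d)) : ℝ :=
  posteriorWeight U V₀ ξ θ / posteriorNorm U V₀ ξ

/-- Posterior mean `∫ θ π_n(θ) dθ`. -/
def posteriorMean {q d n : ℕ} (U : EuclideanSpace ℝ (Fin q) → EuclideanSpace ℝ (Fin d) → ℝ)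
    (V₀ : EuclideanSpace ℝ (Fin d) → ℝ) (ξ : Fin n → EuclideanSpace ℝ (Fin q)) :
    EuclideanSpace ℝ (Fin d) :=
  ∫ θ, posteriorDensity U V₀ ξ θ • θ

/-- The posterior mean is well defined at `ξ`: the posterior density is normalizable, and has a
first moment. -/
def PosteriorMeanExists {q d n : ℕ}
    (U : EuclideanSpace ℝ (Fin q) → EuclideanSpace ℝ (Fin d) → ℝ)
    (V₀ : EuclideanSpace ℝ (Fin d) → ℝ) (ξ : Fin n → EuclideanSpace ℝ (Fin q)) : Prop :=
  Integrable (posteriorWeight U V₀ ξ) ∧ 0 < posteriorNorm U V₀ ξ ∧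
    Integrable fun θ => posteriorDensity U V₀ ξ θ • θ

/-- The `L^p` risk `(𝔼_{θ⋆} |θ̃_n - θ⋆|^p)^{1/p}`, possibly infinite. -/
def posteriorMeanRisk {q d : ℕ} (U : EuclideanSpace ℝ (Fin q) → EuclideanSpace ℝ (Fin d) → ℝ)
    (V₀ : EuclideanSpace ℝ (Fin d) → ℝ) (θs : EuclideanSpace ℝ (Fin d)) (n : ℕ) (p : ℝ) : ℝ≥0∞ :=
  (∫⁻ ξ, ‖posteriorMean U V₀ ξ - θs‖ₑ ^ p ∂(dataLaw U θs n)) ^ (1 / p)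

/-- `ε_n`, where `ε_n² = (CP L²)^{1/α} (d log n / n)^{1/α}`. -/
def epsilonN (CP L α : ℝ) (d n : ℕ) : ℝ :=
  Real.sqrt ((CP * L ^ 2) ^ (1 / α) * ((d : ℝ) * Real.log n / n) ^ (1 / α))

end

/-! The posterior density is controlled pathwise. Write `w` for the posterior weight and `Z` for its
integral. Since `-log w` has an `(nL+1)`-Lipschitz gradient, `Z` dominates `a·w(θ)` for every `θ`,
with `a` of order `(π/(nL+1))^(d/2)`. Applying this at `θ` and at `θ⋆` and taking the geometric mean
gives `w(θ)/Z ≤ a⁻¹ √(w(θ)/w(θ⋆))`. The expectation of the square root of the likelihood ratio is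
the `n`-th power of the Hellinger affinity of `ℙ_θ` and `ℙ_θ⋆`, so Tonelli bounds the expected
posterior `p`-th moment far from `θ⋆`, with no testing argument.

Three ingredients make this effective. The Poincaré inequality gives sub-Gaussian Laplace transforms
of `1`-Lipschitz functions in the range `C l² ≤ 1`; with Cauchy–Schwarz the affinity is at most
`exp(-lδ/2 + C l²)`, where `δ` is the separation of the means of `Ψ`. Identifiability makes `δ` at
least a multiple of `ε_n^α` outside a ball of radius `R ε_n`, so the `n`-th power of the affinity is
at most `exp(-K d log n)` with `K` as large as desired. Finally, `V₀(θ⋆) ≤ κd` forces linear growth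
of `V₀`, so the prior moments and the factor `a⁻¹` cost at most `exp(D d log n)`.

With `K = D + p` the far region contributes at most `n^(-p)`. This is absorbed by `ε_n^p`: comparing
the affinity bound with the lower bound `exp(-L|h|²/2)` (the score has mean zero) shows `√CP ≥
b₁/(2+L)` and `α ≥ 1`, hence `ε_n ≥ c/n`. -/

/-! ### Laplace transforms under a Poincaré inequality -/

section PoincareLaplace

variable {q : ℕ} {μ : Measure (EuclideanSpace ℝ (Fin q))} [IsProbabilityMeasure μ]
  {f : EuclideanSpace ℝ (Fin q) → ℝ} {C B : ℝ}

theorem norm_fderiv_exp_mul_le (hf : LipschitzWith 1 f) (a : ℝ) (x : EuclideanSpace ℝ (Fin q)) :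
    ‖fderiv ℝ (fun y => Real.exp (a * f y)) x‖ ≤ |a| * Real.exp (a * f x) := by
  by_cases ha : a = 0
  · subst ha; simp
  by_cases hd : DifferentiableAt ℝ (fun y => Real.exp (a * f y)) x
  · have hfd : DifferentiableAt ℝ f x := by
      -- Differentiability of `f` is recovered through the logarithm; where the exponential is not
      -- differentiable, its `fderiv` is zero by convention.
      have h1 := hd.log (Real.exp_pos _).ne'
      refine (h1.mul_const a⁻¹).congr_of_eventuallyEq (Filter.Eventually.of_forall fun y => ?_)
      simp only [Real.log_exp]
      field_simp
    rw [((hfd.hasFDerivAt.const_mul a).exp).fderiv, norm_smul, norm_smul, Real.norm_eq_abs,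
      Real.norm_eq_abs, abs_of_pos (Real.exp_pos _)]
    have h2 : ‖fderiv ℝ f x‖ ≤ 1 := by simpa using norm_fderiv_le_of_lipschitz ℝ hf (x₀ := x)
    calc Real.exp (a * f x) * (|a| * ‖fderiv ℝ f x‖)
        ≤ Real.exp (a * f x) * (|a| * 1) := by gcongr
      _ = _ := by ring
  · rw [fderiv_zero_of_not_differentiableAt hd, norm_zero]
    positivity

theorem integrable_exp_mul_of_bounded (hf : Continuous f) (hB : ∀ x, |f x| ≤ B) (a : ℝ) :
    Integrable (fun x => Real.exp (a * f x)) μ := by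
  refine Integrable.of_bound (by fun_prop) (Real.exp (|a| * B))
    (Filter.Eventually.of_forall fun x => ?_)
  rw [Real.norm_eq_abs, abs_of_pos (Real.exp_pos _)]
  refine Real.exp_le_exp.2 ?_
  calc a * f x ≤ |a * f x| := le_abs_self _
    _ = |a| * |f x| := abs_mul _ _
    _ ≤ |a| * B := by gcongr; exact hB x

/-- Poincaré applied to `exp(l f/2)`, whose square is `exp(l f)` and whose gradient has norm at most
`|l/2| exp(l f/2)`. -/
theorem SatisfiesPoincare.laplace_le_sq_add (hP : SatisfiesPoincare μ C) (hC : 0 ≤ C)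
    (hf : LipschitzWith 1 f) (hB : ∀ x, |f x| ≤ B) (l : ℝ) :
    ∫ x, Real.exp (l * f x) ∂μ ≤
      (∫ x, Real.exp (l / 2 * f x) ∂μ) ^ 2 + C * (l ^ 2 / 4) * ∫ x, Real.exp (l * f x) ∂μ := by
  have hfc := hf.continuous
  have hsq : ∀ x, Real.exp (l / 2 * f x) ^ 2 = Real.exp (l * f x) := fun x => by
    rw [← Real.exp_nat_mul]; congr 1; push_cast; ring
  have hmem : MemLp (fun x => Real.exp (l / 2 * f x)) 2 μ := by
    rw [memLp_two_iff_integrable_sq (by fun_prop)]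
    simp only [hsq]
    exact integrable_exp_mul_of_bounded hfc hB l
  have hloc : LocallyLipschitz (fun x => Real.exp (l / 2 * f x)) := by
    have h1 : LocallyLipschitz (fun t : ℝ => Real.exp (l / 2 * t)) :=
      ContDiff.locallyLipschitz (𝕂 := ℝ) (by fun_prop)
    exact h1.comp hf.locallyLipschitz
  have key := hP _ hloc hmem
  rw [← ofReal_variance hmem] at key
  have h2 : ∫⁻ x, ‖fderiv ℝ (fun y => Real.exp (l / 2 * f y)) x‖ₑ ^ 2 ∂μ ≤
      ENNReal.ofReal (l ^ 2 / 4 * ∫ x, Real.exp (l * f x) ∂μ) := by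
    rw [← integral_const_mul, ofReal_integral_eq_lintegral_ofReal
      ((integrable_exp_mul_of_bounded hfc hB l).const_mul _)
      (Filter.Eventually.of_forall fun x => by positivity)]
    refine lintegral_mono fun x => ?_
    rw [← ofReal_norm, ← ENNReal.ofReal_pow (norm_nonneg _)]
    refine ENNReal.ofReal_le_ofReal ?_
    calc ‖fderiv ℝ (fun y => Real.exp (l / 2 * f y)) x‖ ^ 2
        ≤ (|l / 2| * Real.exp (l / 2 * f x)) ^ 2 := by
          gcongr; exact norm_fderiv_exp_mul_le hf _ x
      _ = l ^ 2 / 4 * Real.exp (l * f x) := by rw [mul_pow, hsq, sq_abs]; ring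
  have h3 := key.trans (mul_le_mul_right h2 _)
  have hint : 0 ≤ ∫ x, Real.exp (l * f x) ∂μ := integral_nonneg fun x => (Real.exp_pos _).le
  rw [← ENNReal.ofReal_mul hC, ENNReal.ofReal_le_ofReal_iff (by positivity),
    variance_eq_sub hmem] at h3
  simp only [Pi.pow_apply, hsq] at h3
  linarith

theorem integral_exp_pos_of_bounded (hf : Continuous f) (hB : ∀ x, |f x| ≤ B) (a : ℝ) :
    0 < ∫ x, Real.exp (a * f x) ∂μ :=
  integral_exp_pos (integrable_exp_mul_of_bounded hf hB a)

theorem SatisfiesPoincare.log_laplace_le_half (hP : SatisfiesPoincare μ C) (hC : 0 ≤ C)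
    (hf : LipschitzWith 1 f) (hB : ∀ x, |f x| ≤ B) {l : ℝ} (hl : C * l ^ 2 ≤ 1) :
    Real.log (∫ x, Real.exp (l * f x) ∂μ) ≤
      2 * Real.log (∫ x, Real.exp (l / 2 * f x) ∂μ) + C * l ^ 2 / 2 := by
  have h1 := hP.laplace_le_sq_add hC hf hB l
  have hpos := integral_exp_pos_of_bounded (μ := μ) hf.continuous hB l
  have hpos2 := integral_exp_pos_of_bounded (μ := μ) hf.continuous hB (l / 2)
  set H := ∫ x, Real.exp (l * f x) ∂μ
  set G := ∫ x, Real.exp (l / 2 * f x) ∂μ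
  have hu : 0 ≤ C * l ^ 2 := by positivity
  -- With `u = C l² ≤ 1`, `(1 - u/4)(1 + u/2) ≥ 1`.
  have hinv : 1 ≤ (1 - C * l ^ 2 / 4) * Real.exp (C * l ^ 2 / 2) := by
    have := Real.add_one_le_exp (C * l ^ 2 / 2)
    nlinarith
  have h2 : H ≤ G ^ 2 * Real.exp (C * l ^ 2 / 2) := by
    calc H ≤ H * ((1 - C * l ^ 2 / 4) * Real.exp (C * l ^ 2 / 2)) := le_mul_of_one_le_right hpos.le hinv
      _ = (H - C * (l ^ 2 / 4) * H) * Real.exp (C * l ^ 2 / 2) := by ring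
      _ ≤ _ := by gcongr; linarith
  calc Real.log H ≤ Real.log (G ^ 2 * Real.exp (C * l ^ 2 / 2)) := Real.log_le_log hpos h2
    _ = _ := by rw [Real.log_mul (by positivity) (by positivity), Real.log_exp, Real.log_pow]; simp

/-- Iterated halving: the `j`-th step costs `C l² / 2^(j+1)`, a geometric series of sum `C l²`. -/
theorem SatisfiesPoincare.log_laplace_le_pow (hP : SatisfiesPoincare μ C) (hC : 0 ≤ C)
    (hf : LipschitzWith 1 f) (hB : ∀ x, |f x| ≤ B) {l : ℝ} (hl : C * l ^ 2 ≤ 1) (k : ℕ) :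
    Real.log (∫ x, Real.exp (l * f x) ∂μ) ≤
      2 ^ k * Real.log (∫ x, Real.exp (l / 2 ^ k * f x) ∂μ) + C * l ^ 2 * (1 - 1 / 2 ^ k) := by
  induction k with
  | zero => simp
  | succ k ih =>
    have h1 : C * (l / 2 ^ k) ^ 2 ≤ 1 := by
      refine le_trans ?_ hl
      rw [div_pow]
      gcongr
      exact div_le_self (sq_nonneg _) (one_le_pow₀ (one_le_pow₀ (by norm_num)))
    have h2 := hP.log_laplace_le_half hC hf hB h1
    have h3 : l / 2 ^ k / 2 = l / 2 ^ (k + 1) := by rw [pow_succ]; field_simp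
    rw [h3] at h2
    refine ih.trans ?_
    have h4 := mul_le_mul_of_nonneg_left h2 (by positivity : (0 : ℝ) ≤ 2 ^ k)
    have h5 : (2 : ℝ) ^ k * (C * (l / 2 ^ k) ^ 2 / 2) = C * l ^ 2 * (1 / 2 ^ k - 1 / 2 ^ (k + 1)) := by
      rw [pow_succ]; field_simp; ring
    rw [mul_add, h5] at h4
    have h6 : (2 : ℝ) ^ (k + 1) = 2 ^ k * 2 := pow_succ _ _
    calc _ ≤ _ := add_le_add_left h4 _
      _ = _ := by rw [h6]; ring

/-- In the halving limit, `2^k log 𝔼 exp(l f/2^k)` is at most `l 𝔼 f + o(1)`, because `exp t ≤ 1 + t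
+ t²` for `|t| ≤ 1`; boundedness of `f` makes this uniform. -/
theorem SatisfiesPoincare.laplace_le_of_bounded (hP : SatisfiesPoincare μ C) (hC : 0 ≤ C)
    (hf : LipschitzWith 1 f) (hB : ∀ x, |f x| ≤ B) {l : ℝ} (hl : C * l ^ 2 ≤ 1) :
    ∫ x, Real.exp (l * f x) ∂μ ≤ Real.exp (l * ∫ x, f x ∂μ + C * l ^ 2) := by
  have hfi : Integrable f μ := Integrable.of_bound hf.continuous.aestronglyMeasurable B
    (Filter.Eventually.of_forall hB)
  have hB0 : 0 ≤ B := (abs_nonneg _).trans (hB 0)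
  have hsmall : ∀ m : ℝ, |m| * B ≤ 1 →
      Real.log (∫ x, Real.exp (m * f x) ∂μ) ≤ m * ∫ x, f x ∂μ + m ^ 2 * B ^ 2 := by
    intro m hm
    have h1 : ∫ x, Real.exp (m * f x) ∂μ ≤ ∫ x, (1 + m * f x + m ^ 2 * B ^ 2) ∂μ := by
      refine integral_mono (integrable_exp_mul_of_bounded hf.continuous hB m)
        (((integrable_const _).add (hfi.const_mul m)).add (integrable_const _)) fun x => ?_
      have h2 : |m * f x| ≤ 1 := by
        rw [abs_mul]; exact (mul_le_mul_of_nonneg_left (hB x) (abs_nonneg m)).trans hm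
      have h3 := Real.abs_exp_sub_one_sub_id_le h2
      have h4 : (m * f x) ^ 2 ≤ m ^ 2 * B ^ 2 := by
        rw [mul_pow, ← sq_abs (f x)]
        gcongr
        exact hB x
      have := (abs_le.1 h3).2
      linarith
    have h6 : ∫ x, (1 + m * f x + m ^ 2 * B ^ 2) ∂μ = 1 + m * ∫ x, f x ∂μ + m ^ 2 * B ^ 2 := by
      rw [integral_add (by fun_prop) (integrable_const _),
        integral_add (integrable_const _) (by fun_prop), integral_const_mul]
      simp
    rw [h6] at h1
    have h5 := Real.log_le_sub_one_of_pos
      (integral_exp_pos_of_bounded (μ := μ) hf.continuous hB m)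
    linarith
  have hev : ∀ᶠ k : ℕ in Filter.atTop, Real.log (∫ x, Real.exp (l * f x) ∂μ) ≤
      l * ∫ x, f x ∂μ + C * l ^ 2 + l ^ 2 * B ^ 2 * (1 / 2) ^ k := by
    have ht : Filter.Tendsto (fun k : ℕ => |l| * B * (1 / 2 : ℝ) ^ k) Filter.atTop (nhds 0) := by
      simpa using (tendsto_pow_atTop_nhds_zero_of_lt_one (by norm_num : (0 : ℝ) ≤ 1 / 2)
        (by norm_num)).const_mul (|l| * B)
    filter_upwards [ht.eventually_le_const (by norm_num : (0 : ℝ) < 1)] with k hk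
    have h6 : |l / 2 ^ k| * B ≤ 1 := by
      rw [abs_div, abs_of_pos (by positivity : (0 : ℝ) < 2 ^ k)]
      calc |l| / 2 ^ k * B = |l| * B * (1 / 2) ^ k := by rw [one_div, inv_pow]; field_simp
        _ ≤ 1 := hk
    have h7 := mul_le_mul_of_nonneg_left (hsmall _ h6) (by positivity : (0 : ℝ) ≤ 2 ^ k)
    have h8 := hP.log_laplace_le_pow hC hf hB hl k
    have h9 : (2 : ℝ) ^ k * (l / 2 ^ k * ∫ x, f x ∂μ + (l / 2 ^ k) ^ 2 * B ^ 2) =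
        l * ∫ x, f x ∂μ + l ^ 2 * B ^ 2 * (1 / 2) ^ k := by
      rw [one_div, inv_pow]; field_simp
    have h10 : C * l ^ 2 * (1 - 1 / 2 ^ k) ≤ C * l ^ 2 := by
      refine mul_le_of_le_one_right (by positivity) ?_
      have : (0 : ℝ) ≤ 1 / 2 ^ k := by positivity
      linarith
    linarith
  have hlim : Filter.Tendsto (fun k : ℕ => l * ∫ x, f x ∂μ + C * l ^ 2 +
      l ^ 2 * B ^ 2 * (1 / 2 : ℝ) ^ k) Filter.atTop (nhds (l * ∫ x, f x ∂μ + C * l ^ 2)) := by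
    simpa using ((tendsto_pow_atTop_nhds_zero_of_lt_one (by norm_num : (0 : ℝ) ≤ 1 / 2)
        (by norm_num)).const_mul (l ^ 2 * B ^ 2)).const_add (l * ∫ x, f x ∂μ + C * l ^ 2)
  rw [← Real.log_le_iff_le_exp (integral_exp_pos_of_bounded hf.continuous hB l)]
  exact ge_of_tendsto hlim hev

/-- A negative parameter needs no prior integrability: `0 < 𝔼 exp(-l‖x‖) ≤ exp(-l 𝔼 min(‖x‖, N) + C
l²)` bounds the truncated means uniformly in `N`, and Fatou concludes. -/
theorem SatisfiesPoincare.integrable_norm (hP : SatisfiesPoincare μ C) (hC : 0 ≤ C) :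
    Integrable (fun x : EuclideanSpace ℝ (Fin q) => ‖x‖) μ := by
  set l : ℝ := 1 / (1 + C) with hl
  have hl0 : 0 < l := by positivity
  have hCl : C * (-l) ^ 2 ≤ 1 := by
    rw [neg_sq, hl, div_pow, one_pow, mul_one_div, div_le_one (by positivity)]
    nlinarith
  have hlip : ∀ N : ℕ, LipschitzWith 1 (fun x : EuclideanSpace ℝ (Fin q) => min ‖x‖ (N : ℝ)) :=
    fun N => lipschitzWith_one_norm.min_const _
  have hbd : ∀ (N : ℕ) (x : EuclideanSpace ℝ (Fin q)), |min ‖x‖ (N : ℝ)| ≤ N := fun N x => by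
    rw [abs_of_nonneg (le_min (norm_nonneg _) (Nat.cast_nonneg _))]
    exact min_le_right _ _
  have hint0 : Integrable (fun x : EuclideanSpace ℝ (Fin q) => Real.exp (-l * ‖x‖)) μ := by
    refine Integrable.of_bound (by fun_prop) 1 (Filter.Eventually.of_forall fun x => ?_)
    rw [Real.norm_eq_abs, abs_of_pos (Real.exp_pos _), Real.exp_le_one_iff]
    have := mul_nonneg hl0.le (norm_nonneg x)
    linarith
  set A := ∫ x : EuclideanSpace ℝ (Fin q), Real.exp (-l * ‖x‖) ∂μ
  have hA : 0 < A := integral_exp_pos hint0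
  have hbound : ∀ N : ℕ, ∫ x : EuclideanSpace ℝ (Fin q), min ‖x‖ (N : ℝ) ∂μ ≤
      (C * (-l) ^ 2 - Real.log A) / l := by
    intro N
    have h1 := hP.laplace_le_of_bounded hC (hlip N) (hbd N) hCl
    have h2 : A ≤ ∫ x : EuclideanSpace ℝ (Fin q), Real.exp (-l * min ‖x‖ (N : ℝ)) ∂μ := by
      refine integral_mono hint0
        (integrable_exp_mul_of_bounded (hlip N).continuous (hbd N) (-l)) fun x => ?_
      refine Real.exp_le_exp.2 ?_
      have := mul_le_mul_of_nonneg_left (min_le_left ‖x‖ (N : ℝ)) hl0.le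
      linarith
    have h3 := (Real.log_le_iff_le_exp hA).2 (h2.trans h1)
    rw [le_div_iff₀ hl0]
    linarith
  refine ⟨by fun_prop, ?_⟩
  rw [HasFiniteIntegral]
  have hfatou : ∫⁻ x : EuclideanSpace ℝ (Fin q), ‖(‖x‖)‖ₑ ∂μ ≤
      ENNReal.ofReal ((C * (-l) ^ 2 - Real.log A) / l) := by
    calc ∫⁻ x : EuclideanSpace ℝ (Fin q), ‖(‖x‖)‖ₑ ∂μ
        = ∫⁻ x : EuclideanSpace ℝ (Fin q), Filter.liminf (fun N : ℕ =>
            ENNReal.ofReal (min ‖x‖ (N : ℝ))) Filter.atTop ∂μ := by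
          refine lintegral_congr fun x => ?_
          refine (Filter.Tendsto.liminf_eq (tendsto_const_nhds.congr' ?_)).symm
          filter_upwards [Filter.eventually_ge_atTop ⌈‖x‖⌉₊] with N hN
          rw [min_eq_left (Nat.ceil_le.1 hN), Real.enorm_of_nonneg (norm_nonneg _)]
      _ ≤ Filter.liminf (fun N : ℕ => ∫⁻ x : EuclideanSpace ℝ (Fin q),
            ENNReal.ofReal (min ‖x‖ (N : ℝ)) ∂μ) Filter.atTop :=
          lintegral_liminf_le fun N => by fun_prop
      _ ≤ _ := by
          refine Filter.liminf_le_of_frequently_le' (Filter.Frequently.of_forall fun N => ?_)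
          rw [← ofReal_integral_eq_lintegral_ofReal
            (Integrable.of_bound (hlip N).continuous.aestronglyMeasurable N
              (Filter.Eventually.of_forall (hbd N)))
            (Filter.Eventually.of_forall fun x => le_min (norm_nonneg _) (Nat.cast_nonneg _))]
          exact ENNReal.ofReal_le_ofReal (hbound N)
  exact hfatou.trans_lt ENNReal.ofReal_lt_top

theorem SatisfiesPoincare.integrable_of_lipschitz {F : Type*} [NormedAddCommGroup F]
    [SecondCountableTopology F] {K : ℝ≥0} (hP : SatisfiesPoincare μ C) (hC : 0 ≤ C)
    {g : EuclideanSpace ℝ (Fin q) → F} (hg : LipschitzWith K g) : Integrable g μ := by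
  refine Integrable.mono' (((hP.integrable_norm hC).const_mul (K : ℝ)).add
    (integrable_const ‖g 0‖)) hg.continuous.aestronglyMeasurable
    (Filter.Eventually.of_forall fun x => ?_)
  have h1 := hg.norm_sub_le x 0
  rw [sub_zero] at h1
  have h2 := norm_le_norm_sub_add (g x) (g 0)
  simp only [Pi.add_apply]
  linarith

/-- Truncation at `±N` removes boundedness: means converge by domination, exponentials pass by
Fatou. -/
theorem SatisfiesPoincare.lintegral_exp_le (hP : SatisfiesPoincare μ C) (hC : 0 ≤ C)
    (hf : LipschitzWith 1 f) {l : ℝ} (hl : C * l ^ 2 ≤ 1) :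
    ∫⁻ x, ENNReal.ofReal (Real.exp (l * f x)) ∂μ ≤
      ENNReal.ofReal (Real.exp (l * ∫ x, f x ∂μ + C * l ^ 2)) := by
  have hfc := hf.continuous
  have hfi : Integrable f μ := hP.integrable_of_lipschitz hC hf
  set g : ℕ → EuclideanSpace ℝ (Fin q) → ℝ := fun N x => max (-(N : ℝ)) (min (f x) N) with hg
  have hlip : ∀ N, LipschitzWith 1 (g N) := fun N => (hf.min_const _).const_max _
  have hN : ∀ N : ℕ, -(N : ℝ) ≤ N := fun N => by
    have : (0 : ℝ) ≤ N := Nat.cast_nonneg N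
    linarith
  have hbd : ∀ N x, |g N x| ≤ N := fun N x =>
    abs_le.2 ⟨le_max_left _ _, max_le (hN N) (min_le_right _ _)⟩
  have hev : ∀ x, ∀ᶠ N : ℕ in Filter.atTop, g N x = f x := fun x => by
    filter_upwards [Filter.eventually_ge_atTop ⌈|f x|⌉₊] with N hN
    have h1 := abs_le.1 (Nat.ceil_le.1 hN)
    simp only [hg]
    rw [min_eq_left h1.2, max_eq_right h1.1]
  have hle : ∀ N x, |g N x| ≤ |f x| := fun N x => by
    have hN0 : (0 : ℝ) ≤ N := Nat.cast_nonneg N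
    refine abs_le.2 ⟨?_, max_le ?_ ?_⟩
    · refine le_max_of_le_right (le_min (neg_abs_le _) ?_)
      linarith [abs_nonneg (f x)]
    · linarith [abs_nonneg (f x)]
    · exact (min_le_left _ _).trans (le_abs_self _)
  have hlim : Filter.Tendsto (fun N => ∫ x, g N x ∂μ) Filter.atTop (nhds (∫ x, f x ∂μ)) := by
    refine tendsto_integral_of_dominated_convergence (fun x => |f x|)
      (fun N => (hlip N).continuous.aestronglyMeasurable) hfi.abs
      (fun N => Filter.Eventually.of_forall fun x => hle N x)
      (Filter.Eventually.of_forall fun x => tendsto_const_nhds.congr' ?_)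
    filter_upwards [hev x] with N h using h.symm
  calc ∫⁻ x, ENNReal.ofReal (Real.exp (l * f x)) ∂μ
      = ∫⁻ x, Filter.liminf (fun N : ℕ =>
          ENNReal.ofReal (Real.exp (l * g N x))) Filter.atTop ∂μ := by
        refine lintegral_congr fun x => ?_
        refine (Filter.Tendsto.liminf_eq (tendsto_const_nhds.congr' ?_)).symm
        filter_upwards [hev x] with N h
        rw [h]
    _ ≤ Filter.liminf (fun N : ℕ => ∫⁻ x,
          ENNReal.ofReal (Real.exp (l * g N x)) ∂μ) Filter.atTop := by
        refine lintegral_liminf_le fun N => ?_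
        have := (hlip N).continuous
        fun_prop
    _ ≤ Filter.liminf (fun N : ℕ =>
          ENNReal.ofReal (Real.exp (l * ∫ x, g N x ∂μ + C * l ^ 2))) Filter.atTop := by
        refine Filter.liminf_le_liminf (Filter.Eventually.of_forall fun N => ?_)
        rw [← ofReal_integral_eq_lintegral_ofReal
          (integrable_exp_mul_of_bounded (hlip N).continuous (hbd N) l)
          (Filter.Eventually.of_forall fun x => (Real.exp_pos _).le)]
        exact ENNReal.ofReal_le_ofReal (hP.laplace_le_of_bounded hC (hlip N) (hbd N) hl)
    _ = _ := by
        refine Filter.Tendsto.liminf_eq (ENNReal.tendsto_ofReal ?_)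
        exact (Real.continuous_exp.tendsto _).comp ((hlim.const_mul l).add_const _)

end PoincareLaplace

/-! ### Smooth convex functions and Laplace's method -/

section ConvexSmooth

variable {d : ℕ}

theorem ConvexOn.add_inner_gradient_le {E : Type*} [NormedAddCommGroup E] [InnerProductSpace ℝ E]
    [CompleteSpace E] {φ : E → ℝ} (hc : ConvexOn ℝ Set.univ φ) {x : E}
    (hd : DifferentiableAt ℝ φ x) (y : E) :
    φ x + inner ℝ (gradient φ x) (y - x) ≤ φ y := by
  have h1 : ConvexOn ℝ Set.univ (φ ∘ AffineMap.lineMap (k := ℝ) x y) := by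
    simpa using hc.comp_affineMap (AffineMap.lineMap (k := ℝ) x y)
  have h2 : HasDerivAt (φ ∘ AffineMap.lineMap (k := ℝ) x y) (fderiv ℝ φ x (y - x)) 0 := by
    have h3 : HasFDerivAt φ (fderiv ℝ φ x) (AffineMap.lineMap (k := ℝ) x y 0) := by
      simpa using hd.hasFDerivAt
    exact h3.comp_hasDerivAt 0 AffineMap.hasDerivAt_lineMap
  have h4 := h1.le_slope_of_hasDerivAt (Set.mem_univ 0) (Set.mem_univ 1) one_pos h2
  rw [slope_def_field] at h4
  simp only [Function.comp_apply, AffineMap.lineMap_apply_one, AffineMap.lineMap_apply_zero,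
    sub_zero, div_one] at h4
  rw [inner_gradient_left]
  linarith

/-- Convexity at the endpoint `x + h` replaces integration along the segment; the price is `K` in
place of `K/2`. -/
theorem ConvexOn.le_add_inner_gradient_add_sq {E : Type*} [NormedAddCommGroup E]
    [InnerProductSpace ℝ E] [CompleteSpace E] {φ : E → ℝ} (hc : ConvexOn ℝ Set.univ φ)
    (hd : Differentiable ℝ φ) {K : ℝ} (hK : ∀ x y, ‖gradient φ x - gradient φ y‖ ≤ K * ‖x - y‖)
    (x h : E) : φ (x + h) ≤ φ x + inner ℝ (gradient φ x) h + K * ‖h‖ ^ 2 := by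
  have h1 := hc.add_inner_gradient_le (hd (x + h)) x
  have h2 : x - (x + h) = -h := by abel
  rw [h2, inner_neg_right] at h1
  have h3 : inner ℝ (gradient φ (x + h) - gradient φ x) h ≤ K * ‖h‖ ^ 2 := by
    refine (real_inner_le_norm _ _).trans ?_
    have h4 := hK (x + h) x
    rw [add_sub_cancel_left] at h4
    calc _ ≤ K * ‖h‖ * ‖h‖ := by gcongr
      _ = _ := by ring
  rw [inner_sub_left] at h3
  linarith

theorem lintegral_exp_neg_mul_sq_norm {K : ℝ} (hK : 0 < K) :
    ∫⁻ v : EuclideanSpace ℝ (Fin d), ENNReal.ofReal (Real.exp (-K * ‖v‖ ^ 2)) =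
      ENNReal.ofReal ((Real.pi / K) ^ ((d : ℝ) / 2)) := by
  have h1 := GaussianFourier.integral_rexp_neg_mul_sq_norm (V := EuclideanSpace ℝ (Fin d)) hK
  rw [finrank_euclideanSpace_fin] at h1
  have h2 : Integrable fun v : EuclideanSpace ℝ (Fin d) => Real.exp (-K * ‖v‖ ^ 2) := by
    refine Integrable.of_integral_ne_zero ?_
    rw [h1]
    have := Real.pi_pos
    positivity
  rw [← h1, ofReal_integral_eq_lintegral_ofReal h2
    (Filter.Eventually.of_forall fun v => (Real.exp_pos _).le)]

/-- Laplace lower bound: a function lying below a paraboloid at `x` satisfies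
`e^{-φ x} (π / K)^{d / 2} ≤ ∫ e^{-φ}`. -/
theorem exp_neg_mul_le_lintegral {φ : EuclideanSpace ℝ (Fin d) → ℝ} (hm : Measurable φ)
    {K : ℝ} (hK : 0 < K) {x g : EuclideanSpace ℝ (Fin d)}
    (h : ∀ v, φ (x + v) ≤ φ x + inner ℝ g v + K * ‖v‖ ^ 2) :
    ENNReal.ofReal (Real.exp (-φ x) * (Real.pi / K) ^ ((d : ℝ) / 2)) ≤
      ∫⁻ y, ENNReal.ofReal (Real.exp (-φ y)) := by
  have h1 := lintegral_add_left_eq_self (μ := volume)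
    (fun y => ENNReal.ofReal (Real.exp (-φ y))) x
  have h2 := lintegral_sub_left_eq_self (μ := volume)
    (fun y => ENNReal.ofReal (Real.exp (-φ y))) x
  -- Averaging over `v` and `-v` removes the linear term, since `exp a + exp(-a) ≥ 2`.
  have h3 : ∫⁻ v : EuclideanSpace ℝ (Fin d), ENNReal.ofReal (2 * Real.exp (-φ x)) *
      ENNReal.ofReal (Real.exp (-K * ‖v‖ ^ 2)) ≤
      ∫⁻ v, (ENNReal.ofReal (Real.exp (-φ (x + v))) + ENNReal.ofReal (Real.exp (-φ (x - v)))) := by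
    refine lintegral_mono fun v => ?_
    rw [← ENNReal.ofReal_mul (by positivity), ← ENNReal.ofReal_add (by positivity) (by positivity)]
    refine ENNReal.ofReal_le_ofReal ?_
    have h4 := h v
    have h5 := h (-v)
    rw [inner_neg_right, norm_neg, ← sub_eq_add_neg] at h5
    set a := inner ℝ g v
    set b := K * ‖v‖ ^ 2 with hb
    calc 2 * Real.exp (-φ x) * Real.exp (-K * ‖v‖ ^ 2)
        = Real.exp (-φ x - b) * 2 := by
          rw [sub_eq_add_neg, Real.exp_add, neg_mul]; ring
      _ ≤ Real.exp (-φ x - b) * (Real.exp (-a) + Real.exp a) := by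
          gcongr
          linarith [Real.add_one_le_exp a, Real.add_one_le_exp (-a)]
      _ = Real.exp (-(φ x + a + b)) + Real.exp (-(φ x + -a + b)) := by
          rw [mul_add, ← Real.exp_add, ← Real.exp_add]
          congr 2 <;> ring
      _ ≤ _ := by gcongr
  rw [lintegral_add_left (by fun_prop), h1, h2, lintegral_const_mul _ (by fun_prop),
    lintegral_exp_neg_mul_sq_norm hK, ENNReal.ofReal_mul (by norm_num), mul_assoc,
    ← ENNReal.ofReal_mul (Real.exp_pos _).le, ← two_mul, ENNReal.ofReal_ofNat] at h3
  exact (ENNReal.mul_le_mul_iff_right (by norm_num) (by norm_num)).1 h3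

end ConvexSmooth

/-! ### Growth and moments of the prior -/

section Prior

variable {d : ℕ} {V : EuclideanSpace ℝ (Fin d) → ℝ}

theorem IsC11LogConcavePrior.le_add_inner_add_sq (hV : IsC11LogConcavePrior V)
    (x h : EuclideanSpace ℝ (Fin d)) :
    V (x + h) ≤ V x + inner ℝ (gradient V x) h + 1 * ‖h‖ ^ 2 := by
  refine hV.convex.le_add_inner_gradient_add_sq (hV.contDiff.differentiable one_ne_zero)
    (fun x y => ?_) x h
  simpa using hV.gradient_lipschitz.norm_sub_le x y

/-- A density with `1`-Lipschitz log-gradient cannot peak above `1`, since the Gaussian mass below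
the peak would exceed `1`. -/
theorem IsC11LogConcavePrior.nonneg (hV : IsC11LogConcavePrior V)
    (x : EuclideanSpace ℝ (Fin d)) : 0 ≤ V x := by
  have h1 := exp_neg_mul_le_lintegral hV.contDiff.continuous.measurable one_pos
    (hV.le_add_inner_add_sq x)
  rw [hV.normalized, ← ENNReal.ofReal_one, ENNReal.ofReal_le_ofReal_iff zero_le_one, div_one] at h1
  have h2 : 1 ≤ Real.pi ^ ((d : ℝ) / 2) :=
    Real.one_le_rpow (by linarith [Real.pi_gt_three]) (by positivity)
  have h3 : Real.exp (-V x) ≤ 1 := (le_mul_of_one_le_right (Real.exp_pos _).le h2).trans h1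
  rw [Real.exp_le_one_iff] at h3
  linarith

theorem lintegral_exp_neg_sq_dist_line_le {x : EuclideanSpace ℝ (Fin d)} (hx : x ≠ 0)
    (w : EuclideanSpace ℝ (Fin d)) :
    ∫⁻ s : ℝ, ENNReal.ofReal (Real.exp (-‖w - s • x‖ ^ 2)) ≤
      ENNReal.ofReal (Real.sqrt (Real.pi / ‖x‖ ^ 2)) := by
  have hx0 : 0 < ‖x‖ := norm_pos_iff.2 hx
  have hx2 : 0 < ‖x‖ ^ 2 := by positivity
  rw [← integral_gaussian, ofReal_integral_eq_lintegral_ofReal (integrable_exp_neg_mul_sq hx2)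
    (Filter.Eventually.of_forall fun v => (Real.exp_pos _).le),
    ← lintegral_sub_right_eq_self (fun s => ENNReal.ofReal (Real.exp (-‖x‖ ^ 2 * s ^ 2)))
      (inner ℝ w x / ‖x‖ ^ 2)]
  refine lintegral_mono fun s => ENNReal.ofReal_le_ofReal (Real.exp_le_exp.2 ?_)
  have h1 := abs_real_inner_le_norm (w - s • x) x
  rw [inner_sub_left, real_inner_smul_left, real_inner_self_eq_norm_sq] at h1
  have h2 : (inner ℝ w x - s * ‖x‖ ^ 2) ^ 2 ≤ ‖w - s • x‖ ^ 2 * ‖x‖ ^ 2 := by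
    rw [← sq_abs, ← mul_pow]; gcongr
  have h3 : ‖x‖ ^ 2 * (s - inner ℝ w x / ‖x‖ ^ 2) ^ 2 =
      (inner ℝ w x - s * ‖x‖ ^ 2) ^ 2 / ‖x‖ ^ 2 := by field_simp; ring
  have h4 : (inner ℝ w x - s * ‖x‖ ^ 2) ^ 2 / ‖x‖ ^ 2 ≤ ‖w - s • x‖ ^ 2 := by
    rwa [div_le_iff₀ hx2]
  rw [neg_mul, h3]
  linarith

/-- On the segment `V` stays below the maximum of its end values, and each `exp(-V y)` is at most
the Gaussian-weighted prior mass around `y`. Integrating along the segment, every point `z` receives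
weight at most `√π/‖x‖`, so total mass `1` gives a bound free of the dimension. -/
theorem IsC11LogConcavePrior.norm_mul_exp_neg_max_le (hV : IsC11LogConcavePrior V)
    (θ x : EuclideanSpace ℝ (Fin d)) :
    ‖x‖ * Real.exp (-max (V θ) (V (θ + x))) ≤ 2 := by
  by_cases hx : x = 0
  · simp [hx]
  have hx0 : 0 < ‖x‖ := norm_pos_iff.2 hx
  have hVc := hV.contDiff.continuous
  have hVm := hVc.measurable
  set m := max (V θ) (V (θ + x))
  have hA : ∀ y, ENNReal.ofReal (Real.exp (-V y)) ≤
      ∫⁻ z, ENNReal.ofReal (Real.exp (-V z)) * ENNReal.ofReal (Real.exp (-‖z - y‖ ^ 2)) := by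
    intro y
    -- `K = 2` adds the curvatures of `V` and `‖u‖²`; the factor `(π/2)^(d/2) ≥ 1` is then dropped.
    have h1 := exp_neg_mul_le_lintegral (φ := fun u => V (y + u) + ‖u‖ ^ 2) (by fun_prop)
      (two_pos (α := ℝ)) (x := 0) (g := gradient V y) (fun v => by
        have := hV.le_add_inner_add_sq y v
        simp only [zero_add, add_zero, norm_zero]
        linarith)
    have h2 := lintegral_add_left_eq_self (μ := volume) (fun z =>
      ENNReal.ofReal (Real.exp (-V z)) * ENNReal.ofReal (Real.exp (-‖z - y‖ ^ 2))) y
    rw [← h2]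
    refine le_trans ?_ (h1.trans_eq (lintegral_congr fun u => ?_))
    · refine ENNReal.ofReal_le_ofReal ?_
      simp only [add_zero, norm_zero, ne_eq, OfNat.ofNat_ne_zero, not_false_eq_true, zero_pow]
      exact le_mul_of_one_le_right (Real.exp_pos _).le
        (Real.one_le_rpow (by linarith [Real.pi_gt_three]) (by positivity))
    · rw [← ENNReal.ofReal_mul (Real.exp_pos _).le, ← Real.exp_add, add_sub_cancel_left, neg_add]
  have hB : ∀ s ∈ Set.Icc (0 : ℝ) 1, V (θ + s • x) ≤ m := by
    intro s hs
    have h1 := hV.convex.2 (Set.mem_univ θ) (Set.mem_univ (θ + x)) (sub_nonneg.2 hs.2) hs.1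
      (by ring)
    have h2 : (1 - s) • θ + s • (θ + x) = θ + s • x := by module
    rw [h2, smul_eq_mul, smul_eq_mul] at h1
    have h3 := mul_le_mul_of_nonneg_left (le_max_left (V θ) (V (θ + x))) (sub_nonneg.2 hs.2)
    have h4 := mul_le_mul_of_nonneg_left (le_max_right (V θ) (V (θ + x))) hs.1
    calc _ ≤ _ := h1
      _ ≤ (1 - s) * m + s * m := add_le_add h3 h4
      _ = m := by ring
  have hC : ENNReal.ofReal (Real.exp (-m)) ≤ ENNReal.ofReal (Real.sqrt (Real.pi / ‖x‖ ^ 2)) := by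
    calc ENNReal.ofReal (Real.exp (-m))
        = ∫⁻ _ in Set.Icc (0 : ℝ) 1, ENNReal.ofReal (Real.exp (-m)) := by simp
      _ ≤ ∫⁻ s in Set.Icc (0 : ℝ) 1, ∫⁻ z, ENNReal.ofReal (Real.exp (-V z)) *
            ENNReal.ofReal (Real.exp (-‖z - (θ + s • x)‖ ^ 2)) := by
          refine setLIntegral_mono' measurableSet_Icc fun s hs => le_trans ?_ (hA (θ + s • x))
          exact ENNReal.ofReal_le_ofReal (Real.exp_le_exp.2 (neg_le_neg (hB s hs)))
      _ ≤ ∫⁻ s : ℝ, ∫⁻ z, ENNReal.ofReal (Real.exp (-V z)) *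
            ENNReal.ofReal (Real.exp (-‖z - (θ + s • x)‖ ^ 2)) := setLIntegral_le_lintegral _ _
      _ = ∫⁻ z, ∫⁻ s : ℝ, ENNReal.ofReal (Real.exp (-V z)) *
            ENNReal.ofReal (Real.exp (-‖z - (θ + s • x)‖ ^ 2)) := by
          refine lintegral_lintegral_swap (Measurable.aemeasurable ?_)
          simp only [Function.uncurry_def]
          fun_prop
      _ ≤ ∫⁻ z, ENNReal.ofReal (Real.exp (-V z)) *
            ENNReal.ofReal (Real.sqrt (Real.pi / ‖x‖ ^ 2)) := by
          refine lintegral_mono fun z => ?_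
          rw [lintegral_const_mul _ (by fun_prop)]
          refine mul_le_mul_right ?_ _
          simp only [← sub_sub]
          exact lintegral_exp_neg_sq_dist_line_le hx _
      _ = _ := by rw [lintegral_mul_const _ (by fun_prop), hV.normalized, one_mul]
  rw [ENNReal.ofReal_le_ofReal_iff (Real.sqrt_nonneg _), Real.sqrt_div Real.pi_pos.le,
    Real.sqrt_sq hx0.le, le_div_iff₀ hx0] at hC
  have h5 : Real.sqrt Real.pi ≤ 2 := by
    rw [Real.sqrt_le_left (by norm_num)]
    linarith [Real.pi_le_four]
  linarith

/-- At distance `R` the preceding bound forces `V ≥ k + 1`, one unit above `k ≥ V θ`; convexity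
propagates the slope `1/R` outwards, and nonnegativity covers the ball. -/
theorem IsC11LogConcavePrior.norm_div_sub_one_le (hV : IsC11LogConcavePrior V)
    {θ : EuclideanSpace ℝ (Fin d)} {k : ℝ} (hk : V θ ≤ k) (x : EuclideanSpace ℝ (Fin d)) :
    ‖x‖ / (2 * Real.exp (k + 1)) - 1 ≤ V (θ + x) := by
  set R := 2 * Real.exp (k + 1) with hR
  have hR0 : 0 < R := by positivity
  rcases le_or_gt ‖x‖ R with hxR | hxR
  · have h1 : ‖x‖ / R ≤ 1 := (div_le_one hR0).2 hxR
    linarith [hV.nonneg (θ + x)]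
  have hx0 : 0 < ‖x‖ := hR0.trans hxR
  set t := R / ‖x‖ with ht
  have ht0 : 0 < t := by positivity
  have ht1 : t ≤ 1 := (div_le_one hx0).2 hxR.le
  have h1 := hV.norm_mul_exp_neg_max_le θ (t • x)
  have h2 : ‖t • x‖ = R := by
    rw [norm_smul, Real.norm_of_nonneg ht0.le, ht, div_mul_cancel₀ _ hx0.ne']
  rw [h2, hR, mul_assoc, ← Real.exp_add] at h1
  have h3 : Real.exp (k + 1 + -max (V θ) (V (θ + t • x))) ≤ 1 := by linarith
  rw [Real.exp_le_one_iff] at h3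
  have h4 : k + 1 ≤ V (θ + t • x) := by
    have : k + 1 ≤ max (V θ) (V (θ + t • x)) := by linarith
    rcases le_max_iff.1 this with h | h
    · linarith
    · exact h
  have h5 := hV.convex.2 (Set.mem_univ θ) (Set.mem_univ (θ + x)) (sub_nonneg.2 ht1) ht0.le
    (by ring)
  have h6 : (1 - t) • θ + t • (θ + x) = θ + t • x := by module
  rw [h6, smul_eq_mul, smul_eq_mul] at h5
  have h7 : (1 - t) * V θ ≤ (1 - t) * k := mul_le_mul_of_nonneg_left hk (sub_nonneg.2 ht1)
  have hk0 : 0 ≤ k := (hV.nonneg θ).trans hk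
  have h8 : 1 ≤ t * V (θ + x) := by nlinarith
  have h9 : ‖x‖ / R = 1 / t := by rw [ht, one_div_div]
  have h10 : 1 / t ≤ V (θ + x) := by rw [div_le_iff₀ ht0]; linarith
  linarith

theorem lintegral_comp_smul_euclidean {f : EuclideanSpace ℝ (Fin d) → ℝ≥0∞} (hf : Measurable f)
    {r : ℝ} (hr : 0 < r) :
    ∫⁻ x, f (r • x) = ENNReal.ofReal ((r ^ d)⁻¹) * ∫⁻ x, f x := by
  rw [← lintegral_map (f := f) (g := fun x : EuclideanSpace ℝ (Fin d) => r • x) hf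
    (measurable_const_smul r), Measure.map_addHaar_smul _ hr.ne', lintegral_smul_measure,
    finrank_euclideanSpace_fin, abs_of_pos (by positivity), smul_eq_mul]

/-- Convexity gives `V(θ + x/4) ≤ 3k/4 + V(θ + x)/4`; rescaling by `4` costs `4^d`. -/
theorem IsC11LogConcavePrior.lintegral_exp_neg_quarter_le (hV : IsC11LogConcavePrior V)
    {θ : EuclideanSpace ℝ (Fin d)} {k : ℝ} (hk : V θ ≤ k) :
    ∫⁻ x, ENNReal.ofReal (Real.exp (-(V x / 4))) ≤
      ENNReal.ofReal (Real.exp (3 * k / 4) * 4 ^ d) := by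
  have hVc := hV.contDiff.continuous
  have hVm := hVc.measurable
  rw [← lintegral_add_left_eq_self (μ := volume) _ θ]
  calc ∫⁻ x, ENNReal.ofReal (Real.exp (-(V (θ + x) / 4)))
      ≤ ∫⁻ x, ENNReal.ofReal (Real.exp (3 * k / 4)) *
          ENNReal.ofReal (Real.exp (-V (θ + (1 / 4 : ℝ) • x))) := by
        refine lintegral_mono fun x => ?_
        rw [← ENNReal.ofReal_mul (Real.exp_pos _).le, ← Real.exp_add]
        refine ENNReal.ofReal_le_ofReal (Real.exp_le_exp.2 ?_)
        have h5 := hV.convex.2 (Set.mem_univ θ) (Set.mem_univ (θ + x))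
          (by norm_num : (0 : ℝ) ≤ 3 / 4) (by norm_num : (0 : ℝ) ≤ 1 / 4) (by norm_num)
        have h6 : (3 / 4 : ℝ) • θ + (1 / 4 : ℝ) • (θ + x) = θ + (1 / 4 : ℝ) • x := by module
        rw [h6, smul_eq_mul, smul_eq_mul] at h5
        linarith
    _ = _ := by
        rw [lintegral_const_mul _ (by fun_prop), lintegral_comp_smul_euclidean
          (f := fun x => ENNReal.ofReal (Real.exp (-V (θ + x)))) (by fun_prop) (by norm_num),
          lintegral_add_left_eq_self (μ := volume) (fun x => ENNReal.ofReal (Real.exp (-V x))) θ,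
          hV.normalized, mul_one, ← ENNReal.ofReal_mul (Real.exp_pos _).le]
        simp

theorem Real.rpow_le_mul_exp_div {t p R : ℝ} (ht : 0 ≤ t) (hp : 0 < p) (hR : 0 < R) :
    t ^ p ≤ (R * p) ^ p * Real.exp (t / R) := by
  have h1 : t / (R * p) ≤ Real.exp (t / (R * p)) := by
    linarith [Real.add_one_le_exp (t / (R * p))]
  have h2 : t ≤ R * p * Real.exp (t / (R * p)) := by
    rw [div_le_iff₀ (by positivity)] at h1
    linarith
  calc t ^ p ≤ (R * p * Real.exp (t / (R * p))) ^ p := by gcongr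
    _ = (R * p) ^ p * Real.exp (t / R) := by
      rw [Real.mul_rpow (by positivity) (by positivity), ← Real.exp_mul]
      congr 2
      field_simp

/-- Of the weight `exp(-V/2)`, one factor `exp(-V/4)` absorbs the polynomial by linear growth and
the other is integrated. -/
theorem IsC11LogConcavePrior.lintegral_rpow_mul_exp_le (hV : IsC11LogConcavePrior V)
    {θ : EuclideanSpace ℝ (Fin d)} {k : ℝ} (hk : V θ ≤ k) {p : ℝ} (hp : 0 < p) :
    ∫⁻ x, ENNReal.ofReal (‖x - θ‖ ^ p * Real.exp (-(V x / 2))) ≤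
      ENNReal.ofReal ((8 * Real.exp (k + 1) * p) ^ p * Real.exp (1 / 4) *
        (Real.exp (3 * k / 4) * 4 ^ d)) := by
  have hVc := hV.contDiff.continuous
  rw [ENNReal.ofReal_mul (by positivity)]
  refine le_trans ?_ (mul_le_mul_right (hV.lintegral_exp_neg_quarter_le hk) _)
  rw [← lintegral_const_mul _ (by fun_prop)]
  refine lintegral_mono fun x => ?_
  rw [← ENNReal.ofReal_mul (by positivity)]
  refine ENNReal.ofReal_le_ofReal ?_
  have h1 := hV.norm_div_sub_one_le hk (x - θ)
  rw [add_sub_cancel] at h1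
  have h2 := Real.rpow_le_mul_exp_div (norm_nonneg (x - θ)) hp
    (by positivity : 0 < 8 * Real.exp (k + 1))
  have h3 : ‖x - θ‖ / (8 * Real.exp (k + 1)) = ‖x - θ‖ / (2 * Real.exp (k + 1)) / 4 := by
    rw [div_div]; congr 1; ring
  calc ‖x - θ‖ ^ p * Real.exp (-(V x / 2))
      ≤ (8 * Real.exp (k + 1) * p) ^ p * Real.exp (‖x - θ‖ / (8 * Real.exp (k + 1))) *
          Real.exp (-(V x / 2)) := by gcongr
    _ ≤ (8 * Real.exp (k + 1) * p) ^ p * Real.exp (1 / 4 + V x / 4) *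
          Real.exp (-(V x / 2)) := by
        gcongr
        rw [h3]
        linarith
    _ = _ := by
        rw [mul_assoc, ← Real.exp_add, mul_assoc, mul_assoc, ← Real.exp_add]
        congr 2; ring

end Prior

/-! ### Upper bounds on the Hellinger affinity -/

section Model

variable {q d : ℕ} {U : EuclideanSpace ℝ (Fin q) → EuclideanSpace ℝ (Fin d) → ℝ}

theorem IsLogConcaveModel.continuous (hU : IsLogConcaveModel U) :
    Continuous fun z : EuclideanSpace ℝ (Fin q) × EuclideanSpace ℝ (Fin d) => U z.1 z.2 :=
  hU.convex.locallyLipschitz.continuous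

theorem IsLogConcaveModel.continuous_obs (hU : IsLogConcaveModel U)
    (θ : EuclideanSpace ℝ (Fin d)) : Continuous fun ξ => U ξ θ :=
  hU.continuous.comp (Continuous.prodMk_left θ)

theorem IsLogConcaveModel.continuous_param (hU : IsLogConcaveModel U)
    (ξ : EuclideanSpace ℝ (Fin q)) : Continuous fun θ => U ξ θ :=
  hU.continuous.comp (Continuous.prodMk_right ξ)

theorem IsLogConcaveModel.convexOn_param (hU : IsLogConcaveModel U)
    (ξ : EuclideanSpace ℝ (Fin q)) : ConvexOn ℝ Set.univ (U ξ) := by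
  refine ⟨convex_univ, fun x _ y _ a b ha hb hab => ?_⟩
  have h := hU.convex.2 (Set.mem_univ (ξ, x)) (Set.mem_univ (ξ, y)) ha hb hab
  simpa [← add_smul, hab] using h

theorem lintegral_modelMeasure (hU : IsLogConcaveModel U) (θ : EuclideanSpace ℝ (Fin d))
    {f : EuclideanSpace ℝ (Fin q) → ℝ≥0∞} (hf : Measurable f) :
    ∫⁻ ξ, f ξ ∂(modelMeasure U θ) = ∫⁻ ξ, ENNReal.ofReal (Real.exp (-U ξ θ)) * f ξ := by
  have := hU.continuous_obs θ
  rw [modelMeasure, lintegral_withDensity_eq_lintegral_mul _ (by fun_prop) hf]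
  rfl

theorem isProbabilityMeasure_modelMeasure (hU : IsLogConcaveModel U)
    (θ : EuclideanSpace ℝ (Fin d)) : IsProbabilityMeasure (modelMeasure U θ) := by
  refine ⟨?_⟩
  rw [modelMeasure, withDensity_apply _ MeasurableSet.univ, Measure.restrict_univ]
  exact hU.normalized θ

theorem lintegral_exp_neg_sub_eq_one (hU : IsLogConcaveModel U)
    (θ θs : EuclideanSpace ℝ (Fin d)) :
    ∫⁻ ξ, ENNReal.ofReal (Real.exp (-(U ξ θ - U ξ θs))) ∂(modelMeasure U θs) = 1 := by
  have := hU.continuous_obs θ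
  have := hU.continuous_obs θs
  rw [lintegral_modelMeasure hU θs (by fun_prop), ← hU.normalized θ]
  refine lintegral_congr fun ξ => ?_
  rw [← ENNReal.ofReal_mul (Real.exp_pos _).le, ← Real.exp_add]
  congr 2; ring

/-- Hellinger affinity `∫ √(π_θ π_θs)` of two model distributions. -/
noncomputable def hellingerAffinity (U : EuclideanSpace ℝ (Fin q) → EuclideanSpace ℝ (Fin d) → ℝ)
    (θ θs : EuclideanSpace ℝ (Fin d)) : ℝ≥0∞ :=
  ∫⁻ ξ, ENNReal.ofReal (Real.exp (-((U ξ θ - U ξ θs) / 2))) ∂(modelMeasure U θs)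

/-- Insert `exp(-lψ/2) exp(lψ/2) = 1` and apply Cauchy–Schwarz: the factors are Laplace transforms
of `ψ` under `ℙ_θ` at `-l` and under `ℙ_θs` at `l`. -/
theorem hellingerAffinity_le_of_real (hU : IsLogConcaveModel U) {CP : ℝ} (hCP : 0 ≤ CP)
    (hP : UniformPoincare U CP) {ψ : EuclideanSpace ℝ (Fin q) → ℝ} (hψ : LipschitzWith 1 ψ)
    {l : ℝ} (hl : CP * l ^ 2 ≤ 1) (θ θs : EuclideanSpace ℝ (Fin d)) :
    hellingerAffinity U θ θs ≤ ENNReal.ofReal (Real.exp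
      (-(l * ((∫ ξ, ψ ξ ∂(modelMeasure U θ)) - ∫ ξ, ψ ξ ∂(modelMeasure U θs)) / 2) +
        CP * l ^ 2)) := by
  have := hU.continuous_obs θ
  have := hU.continuous_obs θs
  have hψc := hψ.continuous
  have hsq : ∀ t : ℝ, ENNReal.ofReal (Real.exp (t / 2)) ^ (2 : ℝ) =
      ENNReal.ofReal (Real.exp t) := fun t => by
    rw [ENNReal.ofReal_rpow_of_pos (Real.exp_pos _), ← Real.exp_mul]
    congr 2; ring
  have hbound : ∀ (η : EuclideanSpace ℝ (Fin d)) (m : ℝ), CP * m ^ 2 ≤ 1 →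
      Continuous (fun ξ => U ξ η) →
      (∫⁻ ξ, ENNReal.ofReal (Real.exp ((m * ψ ξ - U ξ η) / 2)) ^ (2 : ℝ)) ^ (1 / (2 : ℝ)) ≤
        ENNReal.ofReal (Real.exp ((m * ∫ ξ, ψ ξ ∂(modelMeasure U η) + CP * m ^ 2) / 2)) := by
    intro η m hm hη
    have := isProbabilityMeasure_modelMeasure hU η
    have h1 := (hP η).lintegral_exp_le hCP hψ hm
    rw [lintegral_modelMeasure hU η (by fun_prop)] at h1
    have h2 : ∫⁻ ξ, ENNReal.ofReal (Real.exp ((m * ψ ξ - U ξ η) / 2)) ^ (2 : ℝ) =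
        ∫⁻ ξ, ENNReal.ofReal (Real.exp (-U ξ η)) * ENNReal.ofReal (Real.exp (m * ψ ξ)) := by
      refine lintegral_congr fun ξ => ?_
      rw [hsq, ← ENNReal.ofReal_mul (Real.exp_pos _).le, ← Real.exp_add]
      congr 2; ring
    rw [h2]
    refine (ENNReal.rpow_le_rpow h1 (by norm_num)).trans_eq ?_
    rw [ENNReal.ofReal_rpow_of_pos (Real.exp_pos _), ← Real.exp_mul]
    congr 2; ring
  have h1 := ENNReal.lintegral_mul_le_Lp_mul_Lq (volume : Measure (EuclideanSpace ℝ (Fin q)))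
    Real.HolderConjugate.two_two
    (f := fun ξ => ENNReal.ofReal (Real.exp ((-l * ψ ξ - U ξ θ) / 2)))
    (g := fun ξ => ENNReal.ofReal (Real.exp ((l * ψ ξ - U ξ θs) / 2)))
    (by fun_prop) (by fun_prop)
  have h2 := mul_le_mul' (hbound θ (-l) (by rwa [neg_sq]) ‹_›) (hbound θs l hl ‹_›)
  rw [hellingerAffinity, lintegral_modelMeasure hU θs (by fun_prop)]
  refine (le_of_eq (lintegral_congr fun ξ => ?_)).trans ((h1.trans h2).trans_eq ?_)
  · rw [Pi.mul_apply, ← ENNReal.ofReal_mul (Real.exp_pos _).le,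
      ← ENNReal.ofReal_mul (Real.exp_pos _).le, ← Real.exp_add, ← Real.exp_add]
    congr 2; ring
  · rw [← ENNReal.ofReal_mul (Real.exp_pos _).le, ← Real.exp_add]
    congr 2; ring

theorem hellingerAffinity_le (hU : IsLogConcaveModel U) {CP : ℝ} (hCP : 0 ≤ CP)
    (hP : UniformPoincare U CP) {m : ℕ}
    {Ψ : EuclideanSpace ℝ (Fin q) → EuclideanSpace ℝ (Fin m)} (hΨ : LipschitzWith 1 Ψ)
    {l : ℝ} (hl : CP * l ^ 2 ≤ 1) (θ θs : EuclideanSpace ℝ (Fin d)) :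
    hellingerAffinity U θ θs ≤ ENNReal.ofReal (Real.exp
      (-(l * ‖(∫ ξ, Ψ ξ ∂(modelMeasure U θ)) - ∫ ξ, Ψ ξ ∂(modelMeasure U θs)‖ / 2) +
        CP * l ^ 2)) := by
  have := isProbabilityMeasure_modelMeasure hU θ
  have := isProbabilityMeasure_modelMeasure hU θs
  have hi : Integrable Ψ (modelMeasure U θ) := (hP θ).integrable_of_lipschitz hCP hΨ
  have his : Integrable Ψ (modelMeasure U θs) := (hP θs).integrable_of_lipschitz hCP hΨ
  set v := (∫ ξ, Ψ ξ ∂(modelMeasure U θ)) - ∫ ξ, Ψ ξ ∂(modelMeasure U θs) with hv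
  -- Projecting `Ψ` on the direction of the mean difference recovers its full norm; `e = 0` when the
  -- means agree.
  set e := ‖v‖⁻¹ • v with he
  have hen : ‖e‖ ≤ 1 := by
    rw [he, norm_smul, norm_inv, norm_norm]
    exact inv_mul_le_one
  have hψ : LipschitzWith 1 (fun ξ => inner ℝ e (Ψ ξ)) := by
    refine LipschitzWith.of_dist_le_mul fun x y => ?_
    rw [dist_eq_norm, ← inner_sub_right, NNReal.coe_one, one_mul]
    have h1 := hΨ.norm_sub_le x y
    rw [NNReal.coe_one, one_mul, ← dist_eq_norm x y] at h1
    calc ‖inner ℝ e (Ψ x - Ψ y)‖ ≤ ‖e‖ * ‖Ψ x - Ψ y‖ := norm_inner_le_norm _ _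
      _ ≤ 1 * dist x y := by gcongr
      _ = _ := one_mul _
  have h2 := hellingerAffinity_le_of_real hU hCP hP hψ hl θ θs
  rw [integral_inner hi, integral_inner his, ← inner_sub_right, ← hv, he, real_inner_smul_left,
    real_inner_self_eq_norm_sq] at h2
  have h3 : ‖v‖⁻¹ * ‖v‖ ^ 2 = ‖v‖ := by
    rcases eq_or_ne ‖v‖ 0 with h | h
    · simp [h]
    · field_simp
  rwa [h3] at h2

/-! ### Mean-zero score and lower bounds on the affinity -/

section Lower

variable {L CP : ℝ}

theorem IsLogConcaveModel.inner_gradient_le_sub (hU : IsLogConcaveModel U) (hS : SmoothModel U L)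
    (ξ : EuclideanSpace ℝ (Fin q)) (θs h : EuclideanSpace ℝ (Fin d)) :
    inner ℝ (gradient (U ξ) θs) h ≤ U ξ (θs + h) - U ξ θs := by
  have := (hU.convexOn_param ξ).add_inner_gradient_le (hS.differentiable ξ θs) (θs + h)
  rw [add_sub_cancel_left] at this
  linarith

theorem IsLogConcaveModel.sub_le_inner_gradient_add (hU : IsLogConcaveModel U)
    (hS : SmoothModel U L) (ξ : EuclideanSpace ℝ (Fin q)) (θs h : EuclideanSpace ℝ (Fin d)) :
    U ξ (θs + h) - U ξ θs ≤ inner ℝ (gradient (U ξ) θs) h + L * ‖h‖ ^ 2 := by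
  have := (hU.convexOn_param ξ).le_add_inner_gradient_add_sq (hS.differentiable ξ)
    (hS.lipschitz_param ξ) θs h
  linarith

theorem SmoothModel.lipschitzWith_gradient (hS : SmoothModel U L)
    (θs : EuclideanSpace ℝ (Fin d)) :
    LipschitzWith L.toNNReal fun ξ => gradient (U ξ) θs := by
  refine LipschitzWith.of_dist_le_mul fun x y => ?_
  rw [dist_eq_norm, dist_eq_norm]
  refine (hS.lipschitz_obs x y θs).trans ?_
  gcongr
  exact Real.le_coe_toNNReal L

theorem integrable_log_ratio (hU : IsLogConcaveModel U) (hS : SmoothModel U L) (hCP : 0 ≤ CP)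
    (hP : UniformPoincare U CP) (hL : 0 ≤ L) (θs h : EuclideanSpace ℝ (Fin d)) :
    Integrable (fun ξ => U ξ (θs + h) - U ξ θs) (modelMeasure U θs) := by
  have := isProbabilityMeasure_modelMeasure hU θs
  have hg : Integrable (fun ξ => gradient (U ξ) θs) (modelMeasure U θs) :=
    (hP θs).integrable_of_lipschitz hCP (hS.lipschitzWith_gradient θs)
  have h1 := hU.continuous_obs (θs + h)
  have h2 := hU.continuous_obs θs
  refine Integrable.mono' ((Integrable.norm (hg.inner_const (𝕜 := ℝ) h)).add (integrable_const (L * ‖h‖ ^ 2)))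
    (by fun_prop) (Filter.Eventually.of_forall fun ξ => ?_)
  have h3 := hU.inner_gradient_le_sub hS ξ θs h
  have h4 := hU.sub_le_inner_gradient_add hS ξ θs h
  have h5 : 0 ≤ L * ‖h‖ ^ 2 := by positivity
  simp only [Pi.add_apply, Real.norm_eq_abs]
  refine abs_le.2 ⟨?_, ?_⟩
  · linarith [neg_abs_le (inner ℝ (gradient (U ξ) θs) h)]
  · linarith [le_abs_self (inner ℝ (gradient (U ξ) θs) h)]

theorem integrable_exp_neg_log_ratio (hU : IsLogConcaveModel U)
    (θ θs : EuclideanSpace ℝ (Fin d)) :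
    Integrable (fun ξ => Real.exp (-(U ξ θ - U ξ θs))) (modelMeasure U θs) := by
  have h1 := hU.continuous_obs θ
  have h2 := hU.continuous_obs θs
  refine (lintegral_ofReal_ne_top_iff_integrable (by fun_prop)
    (Filter.Eventually.of_forall fun ξ => (Real.exp_pos _).le)).1 ?_
  rw [lintegral_exp_neg_sub_eq_one hU]
  exact ENNReal.one_ne_top

/-- Nonnegativity of the Kullback–Leibler divergence, from `exp(-t) ≥ 1 - t`. -/
theorem integral_log_ratio_nonneg (hU : IsLogConcaveModel U) (hS : SmoothModel U L)
    (hCP : 0 ≤ CP) (hP : UniformPoincare U CP) (hL : 0 ≤ L)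
    (θs h : EuclideanSpace ℝ (Fin d)) :
    0 ≤ ∫ ξ, (U ξ (θs + h) - U ξ θs) ∂(modelMeasure U θs) := by
  have := isProbabilityMeasure_modelMeasure hU θs
  have h1 := integrable_log_ratio hU hS hCP hP hL θs h
  have h2 := integrable_exp_neg_log_ratio hU (θs + h) θs
  have h3 : ∫ ξ, Real.exp (-(U ξ (θs + h) - U ξ θs)) ∂(modelMeasure U θs) = 1 := by
    rw [integral_eq_lintegral_of_nonneg_ae
      (Filter.Eventually.of_forall fun ξ => (Real.exp_pos _).le) h2.aestronglyMeasurable,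
      lintegral_exp_neg_sub_eq_one hU, ENNReal.toReal_one]
  have h4 : ∫ ξ, (1 - (U ξ (θs + h) - U ξ θs)) ∂(modelMeasure U θs) ≤ 1 := by
    rw [← h3]
    refine integral_mono ((integrable_const _).sub h1) h2 fun ξ => ?_
    have := Real.add_one_le_exp (-(U ξ (θs + h) - U ξ θs))
    linarith
  rw [integral_sub (integrable_const _) h1, integral_const, probReal_univ, one_smul] at h4
  linarith

theorem integral_log_ratio_le_inner (hU : IsLogConcaveModel U) (hS : SmoothModel U L)
    (hCP : 0 ≤ CP) (hP : UniformPoincare U CP) (hL : 0 ≤ L)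
    (θs h : EuclideanSpace ℝ (Fin d)) :
    ∫ ξ, (U ξ (θs + h) - U ξ θs) ∂(modelMeasure U θs) ≤
      inner ℝ (∫ ξ, gradient (U ξ) θs ∂(modelMeasure U θs)) h + L * ‖h‖ ^ 2 := by
  have := isProbabilityMeasure_modelMeasure hU θs
  have hg : Integrable (fun ξ => gradient (U ξ) θs) (modelMeasure U θs) :=
    (hP θs).integrable_of_lipschitz hCP (hS.lipschitzWith_gradient θs)
  have h1 := integral_mono (integrable_log_ratio hU hS hCP hP hL θs h)
    ((hg.inner_const h).add (integrable_const (L * ‖h‖ ^ 2)))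
    fun ξ => hU.sub_le_inner_gradient_add hS ξ θs h
  refine h1.trans_eq ?_
  simp only [Pi.add_apply]
  rw [integral_add (hg.inner_const h) (integrable_const _), integral_const, probReal_univ,
    one_smul]
  congr 1
  simp_rw [real_inner_comm h]
  rw [integral_inner hg]

/-- No differentiation under the integral: the divergence is nonnegative and at most `⟨G, h⟩ +
L‖h‖²`, and `h = -G/(2L)` makes this `-‖G‖²/(4L)`. -/
theorem integral_score_eq_zero (hU : IsLogConcaveModel U) (hS : SmoothModel U L)
    (hCP : 0 ≤ CP) (hP : UniformPoincare U CP) (hL : 0 < L) (θs : EuclideanSpace ℝ (Fin d)) :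
    ∫ ξ, gradient (U ξ) θs ∂(modelMeasure U θs) = 0 := by
  set G := ∫ ξ, gradient (U ξ) θs ∂(modelMeasure U θs) with hG
  have h1 := (integral_log_ratio_nonneg hU hS hCP hP hL.le θs (-(1 / (2 * L)) • G)).trans
    (integral_log_ratio_le_inner hU hS hCP hP hL.le θs (-(1 / (2 * L)) • G))
  rw [← hG, real_inner_smul_right, real_inner_self_eq_norm_sq, norm_smul, mul_pow,
    Real.norm_eq_abs, sq_abs] at h1
  have h2 : -(1 / (2 * L)) * ‖G‖ ^ 2 + L * ((-(1 / (2 * L))) ^ 2 * ‖G‖ ^ 2) =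
      -(1 / (4 * L)) * ‖G‖ ^ 2 := by field_simp; ring
  rw [h2] at h1
  have h3 : 0 < 1 / (4 * L) := by positivity
  have h4 : ‖G‖ ^ 2 ≤ 0 := by nlinarith
  have h5 : ‖G‖ = 0 := by
    have := sq_nonneg ‖G‖
    exact pow_eq_zero_iff (two_ne_zero) |>.1 (le_antisymm h4 this)
  exact norm_eq_zero.1 h5

/-- Jensen, via the tangent of the exponential at the mean of the half log-ratio; with a mean-zero
score the divergence is at most `L‖h‖²`. -/
theorem exp_neg_le_hellingerAffinity (hU : IsLogConcaveModel U) (hS : SmoothModel U L)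
    (hCP : 0 ≤ CP) (hP : UniformPoincare U CP) (hL : 0 < L)
    (θs h : EuclideanSpace ℝ (Fin d)) :
    ENNReal.ofReal (Real.exp (-(L * ‖h‖ ^ 2 / 2))) ≤ hellingerAffinity U (θs + h) θs := by
  have := isProbabilityMeasure_modelMeasure hU θs
  have h1 := integrable_log_ratio hU hS hCP hP hL.le θs h
  have h2 := integrable_exp_neg_log_ratio hU (θs + h) θs
  have h3 := integral_log_ratio_le_inner hU hS hCP hP hL.le θs h
  rw [integral_score_eq_zero hU hS hCP hP hL, inner_zero_left, zero_add] at h3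
  have c1 := hU.continuous_obs (θs + h)
  have c2 := hU.continuous_obs θs
  set D : EuclideanSpace ℝ (Fin q) → ℝ := fun ξ => U ξ (θs + h) - U ξ θs with hD
  have hDc : Continuous D := by fun_prop
  set a := (∫ ξ, D ξ ∂(modelMeasure U θs)) / 2 with ha
  have h4 : Integrable (fun ξ => Real.exp (-(D ξ / 2))) (modelMeasure U θs) := by
    refine Integrable.mono' ((integrable_const (1 : ℝ)).add h2) (by fun_prop)
      (Filter.Eventually.of_forall fun ξ => ?_)
    rw [Real.norm_eq_abs, abs_of_pos (Real.exp_pos _), Pi.add_apply]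
    have h5 : Real.exp (-(D ξ)) = Real.exp (-(D ξ / 2)) ^ 2 := by
      rw [← Real.exp_nat_mul]; congr 1; push_cast; ring
    change _ ≤ 1 + Real.exp (-(D ξ))
    rw [h5]
    nlinarith [sq_nonneg (Real.exp (-(D ξ / 2)) - 1)]
  have h6 : Real.exp (-a) ≤ ∫ ξ, Real.exp (-(D ξ / 2)) ∂(modelMeasure U θs) := by
    have h7 : ∫ ξ, Real.exp (-a) * ((1 + a) - D ξ / 2) ∂(modelMeasure U θs) = Real.exp (-a) := by
      rw [integral_const_mul, integral_sub (integrable_const _) (h1.div_const 2), integral_const,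
        probReal_univ, one_smul, integral_div, ← ha]
      ring
    rw [← h7]
    refine integral_mono (((integrable_const _).sub (h1.div_const 2)).const_mul _) h4 fun ξ => ?_
    have h8 := Real.add_one_le_exp (a - D ξ / 2)
    have h9 : Real.exp (-(D ξ / 2)) = Real.exp (-a) * Real.exp (a - D ξ / 2) := by
      rw [← Real.exp_add]; congr 1; ring
    simp only [h9]
    gcongr
    linarith
  rw [hellingerAffinity, ← ofReal_integral_eq_lintegral_ofReal h4
    (Filter.Eventually.of_forall fun ξ => (Real.exp_pos _).le)]
  refine ENNReal.ofReal_le_ofReal (le_trans (Real.exp_le_exp.2 ?_) h6)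
  rw [ha]
  linarith

end Lower

/-! ### Consequences of Wasserstein identifiability -/

section Identifiability

variable {L CP b₁ b₂ α : ℝ}

theorem mul_rpow_le_of_identifiability_bound (hb₂ : 0 < b₂) {Δ c : ℝ≥0}
    (h : (if Δ ≤ 1 then b₁ * (Δ : ℝ) ^ α else 0) +
      (if 1 ≤ Δ then b₂ * (Real.log Δ + 1) else 0) ≤ (c : ℝ)) (hΔ : Δ ≤ 1) :
    b₁ * (Δ : ℝ) ^ α ≤ c := by
  rw [if_pos hΔ] at h
  -- At `Δ = 1` both indicators are active; the logarithmic term is then nonnegative.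
  refine le_trans (le_add_of_nonneg_right ?_) h
  split_ifs with h1
  · have := Real.log_nonneg (x := Δ) h1
    positivity
  · exact le_rfl

/-- The affinity at distance `Δ` is at least `exp(-LΔ²/2)` and at most `exp(-lδ/2 + CP l²)`; `l =
Δ/√CP` limits the mean separation `δ`, which identifiability bounds from below. -/
theorem WassersteinIdentifiable.scale_le (hI : WassersteinIdentifiable U b₁ b₂ α)
    (hU : IsLogConcaveModel U) (hS : SmoothModel U L)
    (hCP : 0 < CP) (hP : UniformPoincare U CP) (hL : 0 < L) (hb₂ : 0 < b₂) (hd : 0 < d)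
    {Δ : ℝ} (hΔ : 0 < Δ) (hΔ1 : Δ ≤ 1) :
    b₁ * Δ ^ α ≤ (2 + L) * Real.sqrt CP * Δ := by
  obtain ⟨c, m, Ψ, -, -, hΨ, hc, hlow⟩ := hI
  set h : EuclideanSpace ℝ (Fin d) := EuclideanSpace.single ⟨0, hd⟩ Δ with hh
  have hn : ‖h‖ = Δ := by
    rw [hh, EuclideanSpace.single, PiLp.norm_single, Real.norm_of_nonneg hΔ.le]
  have hs : 0 < Real.sqrt CP := Real.sqrt_pos.2 hCP
  set l := Δ / Real.sqrt CP with hl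
  have hl2 : CP * l ^ 2 = Δ ^ 2 := by
    rw [hl, div_pow, Real.sq_sqrt hCP.le]; field_simp
  have h1 := (exp_neg_le_hellingerAffinity hU hS hCP.le hP hL 0 h).trans
    (hellingerAffinity_le hU hCP.le hP hΨ (by rw [hl2]; exact pow_le_one₀ hΔ.le hΔ1) (0 + h) 0)
  rw [ENNReal.ofReal_le_ofReal_iff (Real.exp_pos _).le, Real.exp_le_exp, hn, hl2] at h1
  have h2 := hc (0 + h) 0
  have h3 : ((nndist (0 + h) 0 : ℝ≥0) : ℝ) = Δ := by
    rw [coe_nndist, dist_zero_right, zero_add, hn]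
  have h8 : b₁ * Δ ^ α ≤ ‖(∫ ξ, Ψ ξ ∂(modelMeasure U (0 + h))) -
      ∫ ξ, Ψ ξ ∂(modelMeasure U 0)‖ := by
    have h4 := mul_rpow_le_of_identifiability_bound hb₂ (hlow (nndist (0 + h) 0))
      (by rw [← NNReal.coe_le_coe, h3]; exact hΔ1)
    rw [h3] at h4
    exact h4.trans h2
  have h9 : l * (b₁ * Δ ^ α) ≤ (2 + L) * Δ ^ 2 := by
    have := mul_le_mul_of_nonneg_left h8 (by positivity : 0 ≤ l)
    linarith
  rw [hl, div_mul_eq_mul_div, div_le_iff₀ hs] at h9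
  have h10 : Δ * (b₁ * Δ ^ α) ≤ Δ * ((2 + L) * Real.sqrt CP * Δ) := by linarith
  exact le_of_mul_le_mul_left h10 hΔ

theorem WassersteinIdentifiable.le_sqrt (hI : WassersteinIdentifiable U b₁ b₂ α)
    (hU : IsLogConcaveModel U) (hS : SmoothModel U L)
    (hCP : 0 < CP) (hP : UniformPoincare U CP) (hL : 0 < L) (hb₂ : 0 < b₂) (hd : 0 < d) :
    b₁ / (2 + L) ≤ Real.sqrt CP := by
  have := hI.scale_le hU hS hCP hP hL hb₂ hd one_pos le_rfl
  rw [Real.one_rpow, mul_one, mul_one] at this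
  rw [div_le_iff₀ (by positivity)]
  linarith

/-- If `α < 1`, dividing the scale inequality by `Δ^α` and letting `Δ → 0` would give `b₁ ≤ 0`. -/
theorem WassersteinIdentifiable.one_le_exponent (hI : WassersteinIdentifiable U b₁ b₂ α)
    (hU : IsLogConcaveModel U) (hS : SmoothModel U L)
    (hCP : 0 < CP) (hP : UniformPoincare U CP) (hL : 0 < L) (hb₁ : 0 < b₁) (hb₂ : 0 < b₂)
    (hd : 0 < d) : 1 ≤ α := by
  by_contra! hα
  set B := (2 + L) * Real.sqrt CP
  have h1 : ∀ᶠ Δ : ℝ in nhdsWithin 0 (Set.Ioi 0), b₁ ≤ B * Δ ^ (1 - α) := by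
    filter_upwards [Ioc_mem_nhdsGT one_pos] with Δ hΔ
    have h2 := hI.scale_le hU hS hCP hP hL hb₂ hd hΔ.1 hΔ.2
    have h3 : 0 < Δ ^ α := Real.rpow_pos_of_pos hΔ.1 _
    rw [Real.rpow_sub hΔ.1, Real.rpow_one, ← mul_div_assoc, le_div_iff₀ h3]
    exact h2
  have h2 : Filter.Tendsto (fun Δ : ℝ => B * Δ ^ (1 - α)) (nhdsWithin 0 (Set.Ioi 0))
      (nhds (B * 0 ^ (1 - α))) :=
    (((Real.continuousAt_rpow_const 0 (1 - α) (Or.inr (by linarith))).tendsto).const_mul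
      B).mono_left nhdsWithin_le_nhds
  rw [Real.zero_rpow (by linarith), mul_zero] at h2
  have := ge_of_tendsto h2 h1
  linarith

/-- Separation of the parameters at distance at least `R * ε`, with the constants chosen so that
both regimes of the identifiability function are covered. -/
theorem WassersteinIdentifiable.exists_separating (hI : WassersteinIdentifiable U b₁ b₂ α)
    (hα : 1 ≤ α) (hb₁ : 0 < b₁) (hb₂ : 0 < b₂) {ε k M : ℝ} (hε : 0 < ε) (hk : 0 ≤ k)
    (hεα : b₁ * ε ^ α ≤ 1) (hM1 : 1 ≤ M) (hM : k / b₁ ≤ M) :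
    ∃ (m : ℕ) (Ψ : EuclideanSpace ℝ (Fin q) → EuclideanSpace ℝ (Fin m)), LipschitzWith 1 Ψ ∧
      ∀ θ θs : EuclideanSpace ℝ (Fin d), M * Real.exp (k / (b₁ * b₂)) * ε ≤ ‖θ - θs‖ →
        k * ε ^ α ≤ ‖(∫ ξ, Ψ ξ ∂(modelMeasure U θ)) - ∫ ξ, Ψ ξ ∂(modelMeasure U θs)‖ := by
  obtain ⟨c, m, Ψ, hmono, -, hΨ, hc, hlow⟩ := hI
  refine ⟨m, Ψ, hΨ, fun θ θs hθ => le_trans ?_ (hc θ θs)⟩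
  have hM0 : 0 < M := by linarith
  have hexp : 1 ≤ Real.exp (k / (b₁ * b₂)) := Real.one_le_exp (by positivity)
  have hnd : ((nndist θ θs : ℝ≥0) : ℝ) = ‖θ - θs‖ := by rw [coe_nndist, dist_eq_norm]
  rcases le_or_gt (M * ε) 1 with h1 | h1
  -- Power regime: `c` is monotone, and `b₁ M^α ≥ b₁ M ≥ k` since `α ≥ 1` and `M ≥ 1`.
  · set Δ : ℝ≥0 := ⟨M * ε, by positivity⟩ with hΔ
    have h2 : Δ ≤ nndist θ θs := by
      rw [← NNReal.coe_le_coe, hnd]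
      refine le_trans ?_ hθ
      calc M * ε ≤ M * Real.exp (k / (b₁ * b₂)) * ε := by
            gcongr; exact le_mul_of_one_le_right hM0.le hexp
        _ = _ := rfl
    have h3 : (c Δ : ℝ) ≤ c (nndist θ θs) := NNReal.coe_le_coe.2 (hmono.monotone h2)
    refine le_trans ?_ h3
    refine le_trans ?_ (mul_rpow_le_of_identifiability_bound hb₂ (hlow Δ) h1)
    change _ ≤ b₁ * (M * ε) ^ α
    rw [Real.mul_rpow hM0.le hε.le]
    have h8 : M ≤ M ^ α := by
      simpa using Real.rpow_le_rpow_of_exponent_le hM1 hα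
    rw [div_le_iff₀ hb₁] at hM
    calc k * ε ^ α ≤ (M * b₁) * ε ^ α := by gcongr
      _ ≤ (M ^ α * b₁) * ε ^ α := by gcongr
      _ = _ := by ring
  -- Logarithmic regime: the exponential factor in the radius gives `b₂ log ‖θ - θs‖ ≥ k/b₁ ≥ k
  -- ε^α`.
  · have h2 : Real.exp (k / (b₁ * b₂)) ≤ ‖θ - θs‖ := by
      refine le_trans ?_ hθ
      calc Real.exp (k / (b₁ * b₂)) ≤ (M * ε) * Real.exp (k / (b₁ * b₂)) :=
            le_mul_of_one_le_left (Real.exp_pos _).le h1.le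
        _ = _ := by ring
    have hpos : 0 < ‖θ - θs‖ := (Real.exp_pos _).trans_le h2
    have h3 := hlow (nndist θ θs)
    have h4 : 1 ≤ nndist θ θs := by
      rw [← NNReal.coe_le_coe, hnd]; exact hexp.trans h2
    have h5 : (0 : ℝ) ≤ if nndist θ θs ≤ 1 then b₁ * ((nndist θ θs : ℝ≥0) : ℝ) ^ α else 0 := by
      split_ifs <;> positivity
    rw [if_pos h4, hnd] at h3
    rw [hnd] at h5
    have h6 : k / (b₁ * b₂) ≤ Real.log ‖θ - θs‖ := (Real.le_log_iff_exp_le hpos).2 h2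
    rw [div_le_iff₀ (by positivity)] at h6
    have h7 : k * (b₁ * ε ^ α) ≤ k * 1 := by gcongr
    have h8 : b₁ * (k * ε ^ α) ≤ b₁ * (b₂ * Real.log ‖θ - θs‖) := by linarith
    have h9 := le_of_mul_le_mul_left h8 hb₁
    linarith

end Identifiability

end Model

/-- Jensen for the probability measure of density `ρ`, through monotonicity of `L^p` norms. -/
theorem enorm_weighted_mean_sub_rpow_le {F : Type*} [NormedAddCommGroup F] [NormedSpace ℝ F]
    [MeasurableSpace F] [BorelSpace F] [SecondCountableTopology F] [CompleteSpace F]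
    {ν : Measure F} {ρ : F → ℝ}
    (h0 : ∀ x, 0 ≤ ρ x) (hm : Measurable ρ) (hone : ∫⁻ x, ENNReal.ofReal (ρ x) ∂ν = 1)
    (hi : Integrable (fun x => ρ x • x) ν) (y : F) {p : ℝ} (hp : 1 ≤ p) :
    ‖(∫ x, ρ x • x ∂ν) - y‖ₑ ^ p ≤ ∫⁻ x, ENNReal.ofReal (ρ x) * ‖x - y‖ₑ ^ p ∂ν := by
  have hρi : Integrable ρ ν := by
    refine (lintegral_ofReal_ne_top_iff_integrable hm.aestronglyMeasurable
      (Filter.Eventually.of_forall h0)).1 ?_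
    rw [hone]; exact ENNReal.one_ne_top
  have hρ1 : ∫ x, ρ x ∂ν = 1 := by
    rw [integral_eq_lintegral_of_nonneg_ae (Filter.Eventually.of_forall h0)
      hm.aestronglyMeasurable, hone, ENNReal.toReal_one]
  set P := ν.withDensity fun x => ENNReal.ofReal (ρ x) with hP
  have : IsProbabilityMeasure P := by
    refine ⟨?_⟩
    rw [hP, withDensity_apply _ MeasurableSet.univ, Measure.restrict_univ, hone]
  have hwd : ∀ f : F → ℝ≥0∞, Measurable f →
      ∫⁻ x, f x ∂P = ∫⁻ x, ENNReal.ofReal (ρ x) * f x ∂ν := fun f hf => by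
    rw [hP, lintegral_withDensity_eq_lintegral_mul _ (by fun_prop) hf]; rfl
  have h1 : (∫ x, ρ x • x ∂ν) - y = ∫ x, ρ x • (x - y) ∂ν := by
    simp_rw [smul_sub]
    rw [integral_sub hi (hρi.smul_const y), integral_smul_const, hρ1, one_smul]
  have h2 : ‖(∫ x, ρ x • x ∂ν) - y‖ₑ ≤ ∫⁻ x, ‖x - y‖ₑ ∂P := by
    rw [h1, hwd _ (by fun_prop)]
    refine (enorm_integral_le_lintegral_enorm _).trans_eq (lintegral_congr fun x => ?_)
    rw [enorm_smul, Real.enorm_of_nonneg (h0 x)]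
  have h3 := eLpNorm'_le_eLpNorm'_of_exponent_le one_pos hp P
    (f := fun x : F => x - y) (by fun_prop)
  simp only [eLpNorm', ENNReal.rpow_one, div_one] at h3
  have h4 := ENNReal.rpow_le_rpow (h2.trans h3) (zero_le_one.trans hp)
  rwa [← ENNReal.rpow_mul, one_div, inv_mul_cancel₀ (by linarith), ENNReal.rpow_one,
    hwd _ (by fun_prop)] at h4

/-! ### Posterior density and expected risk -/

section Posterior

variable {q d n : ℕ} {U : EuclideanSpace ℝ (Fin q) → EuclideanSpace ℝ (Fin d) → ℝ}
  {V : EuclideanSpace ℝ (Fin d) → ℝ} {L k : ℝ}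

theorem isProbabilityMeasure_dataLaw (hU : IsLogConcaveModel U) (θ : EuclideanSpace ℝ (Fin d)) :
    IsProbabilityMeasure (dataLaw U θ n) := by
  have := isProbabilityMeasure_modelMeasure hU θ
  rw [dataLaw]; infer_instance

theorem lintegral_dataLaw_exp_neg_sum (hU : IsLogConcaveModel U)
    (θ : EuclideanSpace ℝ (Fin d)) {g : EuclideanSpace ℝ (Fin q) → ℝ} (hg : Measurable g) :
    ∫⁻ ξ, ENNReal.ofReal (Real.exp (-∑ i, g (ξ i))) ∂(dataLaw U θ n) =
      (∫⁻ x, ENNReal.ofReal (Real.exp (-g x)) ∂(modelMeasure U θ)) ^ n := by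
  have := isProbabilityMeasure_modelMeasure hU θ
  have hm : Measurable fun x => ENNReal.ofReal (Real.exp (-g x)) := by fun_prop
  have hind : iIndepFun (fun (i : Fin n) (ξ : Fin n → EuclideanSpace ℝ (Fin q)) =>
      ENNReal.ofReal (Real.exp (-g (ξ i)))) (Measure.pi fun _ => modelMeasure U θ) :=
    iIndepFun_pi (X := fun _ x => ENNReal.ofReal (Real.exp (-g x))) fun _ => hm.aemeasurable
  have h1 := lintegral_prod_eq_prod_lintegral_of_indepFun Finset.univ _ hind
    fun i => hm.comp (measurable_pi_apply i)
  rw [dataLaw]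
  calc _ = ∫⁻ ξ, ∏ i, ENNReal.ofReal (Real.exp (-g (ξ i)))
        ∂(Measure.pi fun _ : Fin n => modelMeasure U θ) := by
        refine lintegral_congr fun ξ => ?_
        rw [← ENNReal.ofReal_prod_of_nonneg fun i _ => (Real.exp_pos _).le, ← Real.exp_sum,
          Finset.sum_neg_distrib]
    _ = _ := by
        rw [h1]
        have h2 : ∀ i : Fin n, ∫⁻ ξ, ENNReal.ofReal (Real.exp (-g (ξ i)))
            ∂(Measure.pi fun _ : Fin n => modelMeasure U θ) =
            ∫⁻ x, ENNReal.ofReal (Real.exp (-g x)) ∂(modelMeasure U θ) := fun i =>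
          (measurePreserving_eval (fun _ : Fin n => modelMeasure U θ) i).lintegral_comp hm
        simp [h2]

theorem IsLogConcaveModel.continuous_sum (hU : IsLogConcaveModel U)
    (θs : EuclideanSpace ℝ (Fin d)) (s : ℝ) :
    Continuous fun z : (Fin n → EuclideanSpace ℝ (Fin q)) × EuclideanSpace ℝ (Fin d) =>
      ∑ i, s * (U (z.1 i) z.2 - U (z.1 i) θs) := by
  refine continuous_finsetSum _ fun i _ => ?_
  have h1 : Continuous
      fun z : (Fin n → EuclideanSpace ℝ (Fin q)) × EuclideanSpace ℝ (Fin d) => U (z.1 i) z.2 :=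
    hU.continuous.comp
      (f := fun z : (Fin n → EuclideanSpace ℝ (Fin q)) × EuclideanSpace ℝ (Fin d) => (z.1 i, z.2))
      (by fun_prop)
  have h2 : Continuous
      fun z : (Fin n → EuclideanSpace ℝ (Fin q)) × EuclideanSpace ℝ (Fin d) => U (z.1 i) θs :=
    (hU.continuous_obs θs).comp ((continuous_apply i).comp continuous_fst)
  exact continuous_const.mul (h1.sub h2)

/-- Tonelli and independence. The value `s = 1` yields existence of the posterior, `s = 1/2` the
affinity. -/
theorem lintegral_dataLaw_lintegral_mul_exp (hU : IsLogConcaveModel U)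
    (θs : EuclideanSpace ℝ (Fin d)) (s : ℝ) {G : EuclideanSpace ℝ (Fin d) → ℝ≥0∞}
    (hG : Measurable G) :
    ∫⁻ ξ, (∫⁻ θ, G θ * ENNReal.ofReal (Real.exp (-∑ i, s * (U (ξ i) θ - U (ξ i) θs))))
        ∂(dataLaw U θs n) =
      ∫⁻ θ, G θ * (∫⁻ x, ENNReal.ofReal (Real.exp (-(s * (U x θ - U x θs))))
        ∂(modelMeasure U θs)) ^ n := by
  have := isProbabilityMeasure_dataLaw (n := n) hU θs
  have hc := hU.continuous_sum (n := n) θs s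
  have hm : Measurable fun z : (Fin n → EuclideanSpace ℝ (Fin q)) × EuclideanSpace ℝ (Fin d) =>
      ENNReal.ofReal (Real.exp (-∑ i, s * (U (z.1 i) z.2 - U (z.1 i) θs))) := by
    have := hc.measurable
    fun_prop
  rw [lintegral_lintegral_swap ((hG.comp measurable_snd).mul hm).aemeasurable]
  refine lintegral_congr fun θ => ?_
  have hmθ : Measurable fun ξ : Fin n → EuclideanSpace ℝ (Fin q) =>
      ENNReal.ofReal (Real.exp (-∑ i, s * (U (ξ i) θ - U (ξ i) θs))) := by
    have h3 : ∀ (η) (i : Fin n), Measurable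
        fun ξ : Fin n → EuclideanSpace ℝ (Fin q) => U (ξ i) η := fun η i =>
      (hU.continuous_obs η).measurable.comp (measurable_pi_apply i)
    have h4 : Measurable fun ξ : Fin n → EuclideanSpace ℝ (Fin q) =>
        ∑ i, s * (U (ξ i) θ - U (ξ i) θs) :=
      Finset.measurable_fun_sum _ fun i _ => ((h3 θ i).sub (h3 θs i)).const_mul s
    exact ENNReal.measurable_ofReal.comp (Real.measurable_exp.comp h4.neg)
  rw [lintegral_const_mul _ hmθ]
  have h1 := hU.continuous_obs θ
  have h2 := hU.continuous_obs θs
  rw [lintegral_dataLaw_exp_neg_sum (n := n) hU θs (g := fun x => s * (U x θ - U x θs))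
    (by fun_prop)]

theorem posteriorWeight_eq_exp (ξ : Fin n → EuclideanSpace ℝ (Fin q))
    (θ : EuclideanSpace ℝ (Fin d)) :
    posteriorWeight U V ξ θ = Real.exp (-(V θ + ∑ i, U (ξ i) θ)) := by
  rw [posteriorWeight, ← Real.exp_add, neg_add]

theorem continuous_posteriorWeight (hU : IsLogConcaveModel U) (hV : IsC11LogConcavePrior V)
    (ξ : Fin n → EuclideanSpace ℝ (Fin q)) : Continuous (posteriorWeight U V ξ) := by
  have h1 := hV.contDiff.continuous
  have h2 := fun i => hU.continuous_param (ξ i)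
  unfold posteriorWeight
  fun_prop

theorem posteriorWeight_pos (ξ : Fin n → EuclideanSpace ℝ (Fin q))
    (θ : EuclideanSpace ℝ (Fin d)) : 0 < posteriorWeight U V ξ θ := by
  unfold posteriorWeight; positivity

theorem posteriorWeight_mul_le_posteriorNorm (hU : IsLogConcaveModel U)
    (hV : IsC11LogConcavePrior V) (hS : SmoothModel U L) (hL : 0 ≤ L)
    {ξ : Fin n → EuclideanSpace ℝ (Fin q)} (hi : Integrable (posteriorWeight U V ξ))
    (θ : EuclideanSpace ℝ (Fin d)) :
    posteriorWeight U V ξ θ * (Real.pi / (n * L + 1)) ^ ((d : ℝ) / 2) ≤ posteriorNorm U V ξ := by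
  have h1 := hV.contDiff.continuous
  have h2 := fun i => hU.continuous_param (ξ i)
  have h3 := exp_neg_mul_le_lintegral (φ := fun θ => V θ + ∑ i, U (ξ i) θ)
    (Continuous.measurable (by fun_prop)) (by positivity : 0 < n * L + 1) (x := θ)
    (g := gradient V θ + ∑ i, gradient (U (ξ i)) θ) (fun v => by
      have h4 := hV.le_add_inner_add_sq θ v
      have h5 : ∑ i, U (ξ i) (θ + v) ≤
          ∑ i, (U (ξ i) θ + inner ℝ (gradient (U (ξ i)) θ) v + L * ‖v‖ ^ 2) := by
        refine Finset.sum_le_sum fun i _ => ?_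
        have := hU.sub_le_inner_gradient_add hS (ξ i) θ v
        linarith
      rw [Finset.sum_add_distrib, Finset.sum_add_distrib, Finset.sum_const, Finset.card_univ,
        Fintype.card_fin, nsmul_eq_mul] at h5
      rw [inner_add_left, sum_inner]
      linarith)
  have h6 : ∫⁻ θ, ENNReal.ofReal (Real.exp (-(V θ + ∑ i, U (ξ i) θ))) =
      ENNReal.ofReal (posteriorNorm U V ξ) := by
    rw [posteriorNorm, ofReal_integral_eq_lintegral_ofReal hi
      (Filter.Eventually.of_forall fun θ => (posteriorWeight_pos ξ θ).le)]
    simp only [posteriorWeight_eq_exp]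
  have h7 : 0 ≤ posteriorNorm U V ξ := integral_nonneg fun θ => (posteriorWeight_pos ξ θ).le
  rw [h6, ENNReal.ofReal_le_ofReal_iff h7] at h3
  rwa [posteriorWeight_eq_exp]

theorem posteriorNorm_pos (hU : IsLogConcaveModel U)
    (hV : IsC11LogConcavePrior V) (hS : SmoothModel U L) (hL : 0 ≤ L)
    {ξ : Fin n → EuclideanSpace ℝ (Fin q)} (hi : Integrable (posteriorWeight U V ξ)) :
    0 < posteriorNorm U V ξ := by
  refine lt_of_lt_of_le ?_ (posteriorWeight_mul_le_posteriorNorm hU hV hS hL hi 0)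
  have := Real.pi_pos
  have := posteriorWeight_pos (U := U) (V := V) ξ 0
  positivity

/-- Deterministic pointwise bound of the posterior density by the square root of the
likelihood ratio. -/
theorem posteriorDensity_le (hU : IsLogConcaveModel U)
    (hV : IsC11LogConcavePrior V) (hS : SmoothModel U L) (hL : 0 ≤ L)
    {ξ : Fin n → EuclideanSpace ℝ (Fin q)} (hi : Integrable (posteriorWeight U V ξ))
    (θ θs : EuclideanSpace ℝ (Fin d)) (hk : V θs ≤ k) :
    posteriorDensity U V ξ θ ≤ (n * L + 1) ^ ((d : ℝ) / 2) * Real.exp (k / 2) *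
      Real.exp (-(V θ / 2)) * Real.exp (-∑ i, 1 / 2 * (U (ξ i) θ - U (ξ i) θs)) := by
  set K := (n * L + 1 : ℝ) with hK
  have hK0 : 0 < K := by positivity
  have hpi := Real.pi_pos
  set a := (Real.pi / K) ^ ((d : ℝ) / 2) with ha
  have ha0 : 0 < a := by positivity
  have hZ := posteriorNorm_pos hU hV hS hL hi
  have h1 := posteriorWeight_mul_le_posteriorNorm hU hV hS hL hi θ
  have h2 := posteriorWeight_mul_le_posteriorNorm hU hV hS hL hi θs
  rw [posteriorWeight_eq_exp] at h1 h2
  rw [posteriorDensity, div_le_iff₀ hZ, posteriorWeight_eq_exp]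
  set x := V θ + ∑ i, U (ξ i) θ with hx
  set y := V θs + ∑ i, U (ξ i) θs with hy
  set Z := posteriorNorm U V ξ
  -- `Z` dominates `a` times the weight at `θ` and at `θs`, hence `a` times their geometric mean.
  have h3 : a * Real.exp (-(x + y) / 2) ≤ Z := by
    refine (sq_le_sq₀ (by positivity) hZ.le).1 ?_
    calc (a * Real.exp (-(x + y) / 2)) ^ 2 = (Real.exp (-x) * a) * (Real.exp (-y) * a) := by
          have h4 : Real.exp (-(x + y) / 2) ^ 2 = Real.exp (-x) * Real.exp (-y) := by
            rw [← Real.exp_nat_mul, ← Real.exp_add]; congr 1; push_cast; ring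
          rw [mul_pow, h4]; ring
      _ ≤ Z * Z := by gcongr
      _ = Z ^ 2 := by ring
  have h5 : 1 ≤ K ^ ((d : ℝ) / 2) * a := by
    rw [ha, ← Real.mul_rpow hK0.le (by positivity), mul_div_cancel₀ _ hK0.ne']
    exact Real.one_le_rpow (by linarith [Real.pi_gt_three]) (by positivity)
  have h6 : ∑ i, 1 / 2 * (U (ξ i) θ - U (ξ i) θs) = (x - V θ - (y - V θs)) / 2 := by
    rw [← Finset.mul_sum, Finset.sum_sub_distrib, hx, hy]; ring
  rw [h6]
  calc Real.exp (-x) = 1 * (Real.exp (-((x - y) / 2)) * Real.exp (-(x + y) / 2)) := by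
        rw [one_mul, ← Real.exp_add]; congr 1; ring
    _ ≤ (K ^ ((d : ℝ) / 2) * a) * (Real.exp (-((x - y) / 2)) * Real.exp (-(x + y) / 2)) := by
        gcongr
    _ = K ^ ((d : ℝ) / 2) * Real.exp (-((x - y) / 2)) * (a * Real.exp (-(x + y) / 2)) := by ring
    _ ≤ K ^ ((d : ℝ) / 2) * Real.exp (k / 2 - V θ / 2 - (x - V θ - (y - V θs)) / 2) * Z := by
        gcongr
        linarith
    _ = _ := by
        rw [mul_assoc _ (Real.exp (k / 2)), mul_assoc _ (Real.exp (k / 2) * _), ← Real.exp_add,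
          ← Real.exp_add]
        congr 3

theorem IsC11LogConcavePrior.lintegral_one_add_norm_mul_exp_ne_top (hV : IsC11LogConcavePrior V)
    (θs : EuclideanSpace ℝ (Fin d)) :
    ∫⁻ θ, ENNReal.ofReal ((1 + ‖θ - θs‖) * Real.exp (-V θ)) ≠ ∞ := by
  have hc := hV.contDiff.continuous
  have h1 := hV.lintegral_rpow_mul_exp_le (le_refl (V θs)) one_pos
  refine ne_top_of_le_ne_top (ENNReal.add_ne_top.2 ⟨ENNReal.one_ne_top,
    ne_top_of_le_ne_top ENNReal.ofReal_ne_top h1⟩) ?_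
  rw [← hV.normalized, ← lintegral_add_left (by fun_prop)]
  refine lintegral_mono fun θ => ?_
  rw [← ENNReal.ofReal_add (by positivity) (by positivity), add_mul, one_mul, Real.rpow_one]
  refine ENNReal.ofReal_le_ofReal ?_
  gcongr
  linarith [hV.nonneg θ]

/-- The likelihood ratio has expectation one, so the expected weighted integral equals the finite
first-moment integral of the prior; it is thus almost surely finite. -/
theorem ae_posteriorMeanExists (hU : IsLogConcaveModel U)
    (hV : IsC11LogConcavePrior V) (hS : SmoothModel U L) (hL : 0 ≤ L)
    (θs : EuclideanSpace ℝ (Fin d)) :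
    ∀ᵐ ξ ∂(dataLaw U θs n), PosteriorMeanExists U V ξ := by
  have := isProbabilityMeasure_dataLaw (n := n) hU θs
  have hVc := hV.contDiff.continuous
  have h1 := lintegral_dataLaw_lintegral_mul_exp (n := n) hU θs 1
    (G := fun θ => ENNReal.ofReal ((1 + ‖θ - θs‖) * Real.exp (-V θ))) (by fun_prop)
  simp only [one_mul, lintegral_exp_neg_sub_eq_one hU, one_pow, mul_one] at h1
  have hc := hU.continuous_sum (n := n) θs 1
  simp only [one_mul] at hc
  have hcm := hc.measurable
  have hm : Measurable fun z : (Fin n → EuclideanSpace ℝ (Fin q)) × EuclideanSpace ℝ (Fin d) =>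
      ENNReal.ofReal ((1 + ‖z.2 - θs‖) * Real.exp (-V z.2)) *
        ENNReal.ofReal (Real.exp (-∑ i, (U (z.1 i) z.2 - U (z.1 i) θs))) := by
    fun_prop
  have h2 := ae_lt_top (μ := dataLaw U θs n) hm.lintegral_prod_right'
    (h1.trans_ne (hV.lintegral_one_add_norm_mul_exp_ne_top θs))
  filter_upwards [h2] with ξ hξ
  have hwc := continuous_posteriorWeight hU hV ξ
  have hkey : Integrable fun θ => (1 + ‖θ - θs‖) * posteriorWeight U V ξ θ := by
    refine (lintegral_ofReal_ne_top_iff_integrable (Continuous.aestronglyMeasurable (by fun_prop))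
      (Filter.Eventually.of_forall fun θ =>
        mul_nonneg (by positivity) (posteriorWeight_pos ξ θ).le)).1 ?_
    have h3 : ∀ θ, ENNReal.ofReal ((1 + ‖θ - θs‖) * posteriorWeight U V ξ θ) =
        ENNReal.ofReal (Real.exp (-∑ i, U (ξ i) θs)) *
        (ENNReal.ofReal ((1 + ‖θ - θs‖) * Real.exp (-V θ)) *
        ENNReal.ofReal (Real.exp (-∑ i, (U (ξ i) θ - U (ξ i) θs)))) := fun θ => by
      rw [← ENNReal.ofReal_mul (by positivity), ← ENNReal.ofReal_mul (by positivity),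
        posteriorWeight]
      congr 1
      have h4 : Real.exp (-∑ i, U (ξ i) θ) = Real.exp (-∑ i, U (ξ i) θs) *
          Real.exp (-∑ i, (U (ξ i) θ - U (ξ i) θs)) := by
        rw [← Real.exp_add, Finset.sum_sub_distrib]; congr 1; ring
      rw [h4]; ring
    simp_rw [h3]
    have hmξ : Measurable fun θ => ENNReal.ofReal ((1 + ‖θ - θs‖) * Real.exp (-V θ)) *
        ENNReal.ofReal (Real.exp (-∑ i, (U (ξ i) θ - U (ξ i) θs))) := by
      have h5 := fun i => hU.continuous_param (ξ i)
      fun_prop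
    rw [lintegral_const_mul _ hmξ]
    exact ENNReal.mul_ne_top ENNReal.ofReal_ne_top hξ.ne
  have hi : Integrable (posteriorWeight U V ξ) := by
    refine hkey.mono' hwc.aestronglyMeasurable (Filter.Eventually.of_forall fun θ => ?_)
    rw [Real.norm_of_nonneg (posteriorWeight_pos ξ θ).le]
    refine le_mul_of_one_le_left (posteriorWeight_pos ξ θ).le ?_
    linarith [norm_nonneg (θ - θs)]
  refine ⟨hi, posteriorNorm_pos hU hV hS hL hi, ?_⟩
  have h5 : Integrable fun θ => posteriorWeight U V ξ θ • (θ - θs) := by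
    refine hkey.mono' (Continuous.aestronglyMeasurable (by fun_prop))
      (Filter.Eventually.of_forall fun θ => ?_)
    rw [norm_smul, Real.norm_of_nonneg (posteriorWeight_pos ξ θ).le, mul_comm]
    exact mul_le_mul_of_nonneg_right (by linarith) (posteriorWeight_pos ξ θ).le
  have h6 := (h5.add (hi.smul_const θs)).smul (posteriorNorm U V ξ)⁻¹
  refine h6.congr (Filter.Eventually.of_forall fun θ => ?_)
  simp only [Pi.add_apply, Pi.smul_apply, ← smul_add, sub_add_cancel, smul_smul,
    posteriorDensity, div_eq_inv_mul]

theorem enorm_posteriorMean_sub_rpow_le (hU : IsLogConcaveModel U)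
    (hV : IsC11LogConcavePrior V) {ξ : Fin n → EuclideanSpace ℝ (Fin q)}
    (hE : PosteriorMeanExists U V ξ) (θs : EuclideanSpace ℝ (Fin d)) {p : ℝ} (hp : 1 ≤ p)
    (r : ℝ) :
    ‖posteriorMean U V ξ - θs‖ₑ ^ p ≤ ENNReal.ofReal (r ^ p) +
      ∫⁻ θ in {θ | r ≤ ‖θ - θs‖},
        ENNReal.ofReal (posteriorDensity U V ξ θ * ‖θ - θs‖ ^ p) := by
  obtain ⟨hi, hZ, hm⟩ := hE
  have hwc := continuous_posteriorWeight hU hV ξ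
  have h0 : ∀ θ, 0 ≤ posteriorDensity U V ξ θ := fun θ =>
    div_nonneg (posteriorWeight_pos ξ θ).le hZ.le
  have hdc : Continuous (posteriorDensity U V ξ) := by
    unfold posteriorDensity; fun_prop
  have hone : ∫⁻ θ, ENNReal.ofReal (posteriorDensity U V ξ θ) = 1 := by
    have h1 : Integrable (posteriorDensity U V ξ) := hi.div_const _
    rw [← ofReal_integral_eq_lintegral_ofReal h1 (Filter.Eventually.of_forall h0)]
    unfold posteriorDensity
    rw [integral_div, ← posteriorNorm, div_self hZ.ne', ENNReal.ofReal_one]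
  have hA : MeasurableSet {θ : EuclideanSpace ℝ (Fin d) | r ≤ ‖θ - θs‖} :=
    measurableSet_le measurable_const (by fun_prop)
  have hp0 : 0 ≤ p := zero_le_one.trans hp
  refine (enorm_weighted_mean_sub_rpow_le h0 hdc.measurable hone hm θs hp).trans ?_
  rw [← mul_one (ENNReal.ofReal (r ^ p)), ← hone, ← lintegral_const_mul _ (by fun_prop),
    ← lintegral_indicator hA, ← lintegral_add_left (by fun_prop)]
  refine lintegral_mono fun θ => ?_
  have hn : ‖θ - θs‖ₑ ^ p = ENNReal.ofReal (‖θ - θs‖ ^ p) := by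
    rw [← ofReal_norm, ENNReal.ofReal_rpow_of_nonneg (norm_nonneg _) hp0]
  rw [hn]
  by_cases hθ : r ≤ ‖θ - θs‖
  · rw [Set.indicator_of_mem (show θ ∈ {θ | r ≤ ‖θ - θs‖} from hθ), ← ENNReal.ofReal_mul (h0 θ)]
    exact le_add_self
  · rw [Set.indicator_of_notMem (show θ ∉ {θ | r ≤ ‖θ - θs‖} from hθ), add_zero, mul_comm]
    push Not at hθ
    gcongr

/-- Outside the radius `r`, the density bound is integrated over the data first, turning the
likelihood factor into the affinity to the power `n`; the prior moment handles `θ`. -/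
theorem lintegral_posteriorMean_sub_rpow_le (hU : IsLogConcaveModel U)
    (hV : IsC11LogConcavePrior V) (hS : SmoothModel U L) (hL : 0 ≤ L)
    {θs : EuclideanSpace ℝ (Fin d)} (hk : V θs ≤ k) {p : ℝ} (hp : 1 ≤ p)
    {r : ℝ} {S : ℝ≥0∞}
    (hS' : ∀ θ, r ≤ ‖θ - θs‖ → hellingerAffinity U θ θs ≤ S) :
    ∫⁻ ξ, ‖posteriorMean U V ξ - θs‖ₑ ^ p ∂(dataLaw U θs n) ≤ ENNReal.ofReal (r ^ p) +
      ENNReal.ofReal ((n * L + 1) ^ ((d : ℝ) / 2) * Real.exp (k / 2) *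
        ((8 * Real.exp (k + 1) * p) ^ p * Real.exp (1 / 4) *
          (Real.exp (3 * k / 4) * 4 ^ d))) * S ^ n := by
  have := isProbabilityMeasure_dataLaw (n := n) hU θs
  have hVc := hV.contDiff.continuous
  have hA : MeasurableSet {θ : EuclideanSpace ℝ (Fin d) | r ≤ ‖θ - θs‖} :=
    measurableSet_le measurable_const (by fun_prop)
  set A := {θ : EuclideanSpace ℝ (Fin d) | r ≤ ‖θ - θs‖} with hAdef
  have hK0 : (0 : ℝ) ≤ (n * L + 1) ^ ((d : ℝ) / 2) * Real.exp (k / 2) := by positivity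
  set G : EuclideanSpace ℝ (Fin d) → ℝ≥0∞ := fun θ =>
    ENNReal.ofReal ((n * L + 1) ^ ((d : ℝ) / 2) * Real.exp (k / 2)) *
      ENNReal.ofReal (‖θ - θs‖ ^ p * Real.exp (-(V θ / 2))) with hG
  have hGm : Measurable G := by fun_prop
  have haff : ∀ θ, ∫⁻ x, ENNReal.ofReal (Real.exp (-(1 / 2 * (U x θ - U x θs))))
      ∂(modelMeasure U θs) = hellingerAffinity U θ θs := fun θ => by
    rw [hellingerAffinity]
    refine lintegral_congr fun x => ?_
    congr 3; ring
  calc ∫⁻ ξ, ‖posteriorMean U V ξ - θs‖ₑ ^ p ∂(dataLaw U θs n)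
      ≤ ∫⁻ ξ, (ENNReal.ofReal (r ^ p) + ∫⁻ θ, A.indicator G θ *
          ENNReal.ofReal (Real.exp (-∑ i, 1 / 2 * (U (ξ i) θ - U (ξ i) θs))))
          ∂(dataLaw U θs n) := by
        refine lintegral_mono_ae ?_
        filter_upwards [ae_posteriorMeanExists hU hV hS hL θs] with ξ hξ
        refine (enorm_posteriorMean_sub_rpow_le hU hV hξ θs hp r).trans ?_
        refine add_le_add_right ?_ _
        rw [← lintegral_indicator hA]
        refine lintegral_mono fun θ => ?_
        by_cases hθ : θ ∈ A
        · rw [Set.indicator_of_mem hθ, Set.indicator_of_mem hθ, hG]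
          simp only
          rw [← ENNReal.ofReal_mul hK0, ← ENNReal.ofReal_mul (by positivity)]
          refine ENNReal.ofReal_le_ofReal ?_
          have h1 := posteriorDensity_le hU hV hS hL hξ.1 θ θs hk
          refine (mul_le_mul_of_nonneg_right h1 (by positivity)).trans_eq ?_
          ring
        · rw [Set.indicator_of_notMem hθ]
          exact zero_le
    _ = ENNReal.ofReal (r ^ p) + ∫⁻ θ, A.indicator G θ * hellingerAffinity U θ θs ^ n := by
        rw [lintegral_add_left measurable_const, lintegral_const, measure_univ, mul_one,
          lintegral_dataLaw_lintegral_mul_exp hU θs (1 / 2) (hGm.indicator hA)]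
        simp only [haff]
    _ ≤ ENNReal.ofReal (r ^ p) + ∫⁻ θ, G θ * S ^ n := by
        refine add_le_add_right (lintegral_mono fun θ => ?_) _
        by_cases hθ : θ ∈ A
        · rw [Set.indicator_of_mem hθ]
          gcongr
          exact hS' θ hθ
        · rw [Set.indicator_of_notMem hθ, zero_mul]
          exact zero_le
    _ ≤ _ := by
        rw [lintegral_mul_const _ hGm, hG, lintegral_const_mul _ (by fun_prop),
          ENNReal.ofReal_mul hK0]
        gcongr
        exact hV.lintegral_rpow_mul_exp_le hk (by linarith)

end Posterior

/-! ### Size of the rate and of the constants -/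

section Rate

theorem epsilonN_eq_rpow {CP L α : ℝ} (hCP : 0 ≤ CP) (hL : 0 ≤ L) (d n : ℕ) :
    epsilonN CP L α d n =
      (Real.sqrt CP * L * Real.sqrt ((d : ℝ) * Real.log n / n)) ^ (1 / α) := by
  have hx : 0 ≤ (d : ℝ) * Real.log n / n := by positivity
  have hT : 0 ≤ Real.sqrt CP * L * Real.sqrt ((d : ℝ) * Real.log n / n) := by positivity
  rw [epsilonN, ← Real.mul_rpow (by positivity) hx]
  have h1 : CP * L ^ 2 * ((d : ℝ) * Real.log n / n) =
      (Real.sqrt CP * L * Real.sqrt ((d : ℝ) * Real.log n / n)) ^ 2 := by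
    rw [mul_pow, mul_pow, Real.sq_sqrt hCP, Real.sq_sqrt hx]
  rw [h1, ← Real.rpow_natCast, ← Real.rpow_mul hT, mul_comm (_ : ℝ) (1 / α), Real.rpow_mul hT, Real.rpow_natCast,
    Real.sqrt_sq (by positivity)]

theorem rate_eq_epsilonN {CP L α : ℝ} (hCP : 0 ≤ CP) (hL : 0 ≤ L) (d n : ℕ) :
    (Real.sqrt CP * L) ^ (1 / α) * ((d : ℝ) * Real.log n / n) ^ (1 / (2 * α)) =
      epsilonN CP L α d n := by
  have hx : 0 ≤ (d : ℝ) * Real.log n / n := by positivity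
  rw [epsilonN_eq_rpow hCP hL, Real.mul_rpow (by positivity) (Real.sqrt_nonneg _),
    Real.sqrt_eq_rpow ((d : ℝ) * Real.log n / n), ← Real.rpow_mul hx]
  congr 2
  rw [one_div_mul_one_div]

theorem epsilonN_rpow {CP L α : ℝ} (hCP : 0 ≤ CP) (hL : 0 ≤ L) (hα : α ≠ 0) (d n : ℕ) :
    epsilonN CP L α d n ^ α = Real.sqrt CP * L * Real.sqrt ((d : ℝ) * Real.log n / n) := by
  rw [epsilonN_eq_rpow hCP hL, ← Real.rpow_mul (by positivity), one_div_mul_cancel hα,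
    Real.rpow_one]

theorem half_le_log_natCast {n : ℕ} (hn : 2 ≤ n) : 1 / 2 ≤ Real.log n := by
  have h1 : Real.log 2 ≤ Real.log n := Real.log_le_log (by norm_num) (by exact_mod_cast hn)
  linarith [Real.log_two_gt_d9]

/-- The base of `ε_n` is at least `c/n ≤ 1`, and the exponent `1/α ≤ 1` can only enlarge such a
number. -/
theorem div_le_epsilonN {CP L α g : ℝ} (hL : 0 < L) (hα : 1 ≤ α) (hg : 0 < g)
    (hgCP : g ≤ Real.sqrt CP) (hCP : 0 ≤ CP) {d n : ℕ} (hd : 0 < d) (hn : 2 ≤ n) :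
    min 1 (g * L / 2) / n ≤ epsilonN CP L α d n := by
  have hn0 : (0 : ℝ) < n := by positivity
  have hn1 : (1 : ℝ) ≤ n := by exact_mod_cast (by omega : 1 ≤ n)
  have hd1 : (1 : ℝ) ≤ d := by exact_mod_cast hd
  have hlog := half_le_log_natCast hn
  set c := min 1 (g * L / 2) with hc
  have hc0 : 0 < c := by positivity
  have hsq : 1 / (2 * n) ≤ Real.sqrt ((d : ℝ) * Real.log n / n) := by
    refine Real.le_sqrt_of_sq_le ?_
    have h1 : 1 / (2 * (n : ℝ)) ≤ 1 := by
      rw [div_le_one (by positivity)]; linarith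
    calc (1 / (2 * (n : ℝ))) ^ 2 ≤ 1 / (2 * n) := by
          rw [sq]; exact mul_le_of_le_one_left (by positivity) h1
      _ = 1 * (1 / 2) / n := by field_simp
      _ ≤ _ := by gcongr
  have hT : c / n ≤ Real.sqrt CP * L * Real.sqrt ((d : ℝ) * Real.log n / n) := by
    calc c / n ≤ (g * L / 2) / n := by gcongr; exact min_le_right _ _
      _ = g * L * (1 / (2 * n)) := by field_simp
      _ ≤ _ := by gcongr
  have hcn : c / n ≤ 1 := by
    rw [div_le_one hn0]; exact (min_le_left _ _).trans hn1
  rw [epsilonN_eq_rpow hCP hL.le]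
  calc c / n = (c / n) ^ (1 : ℝ) := (Real.rpow_one _).symm
    _ ≤ (c / n) ^ (1 / α) :=
        Real.rpow_le_rpow_of_exponent_ge (by positivity) hcn
          ((div_le_one (by linarith)).2 hα)
    _ ≤ _ := by gcongr

/-- Exponential growth rate, in units of `d * log n`, of the constants in the posterior bound. -/
noncomputable def entropyRate (p L κ : ℝ) : ℝ :=
  1 / 2 + 2 * (1 / 2 * Real.log (1 + L) + (5 / 4 + p) * |κ| + Real.log 4 +
    p * (Real.log (8 * p) + 1) + 1 / 4)

theorem posterior_constant_le_exp {p L κ : ℝ} (hp : 1 < p) (hL : 0 < L) {d n : ℕ} (hd : 0 < d)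
    (hn : 2 ≤ n) :
    (n * L + 1) ^ ((d : ℝ) / 2) * Real.exp (|κ| * d / 2) *
        ((8 * Real.exp (|κ| * d + 1) * p) ^ p * Real.exp (1 / 4) *
          (Real.exp (3 * (|κ| * d) / 4) * 4 ^ d)) ≤
      Real.exp (entropyRate p L κ * (d * Real.log n)) := by
  have hn0 : (0 : ℝ) < n := by positivity
  have hn1 : (1 : ℝ) ≤ n := by exact_mod_cast (by omega : 1 ≤ n)
  have hd1 : (1 : ℝ) ≤ d := by exact_mod_cast hd
  have hlog := half_le_log_natCast hn
  have h1 : (n * L + 1) ^ ((d : ℝ) / 2) ≤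
      Real.exp ((d : ℝ) / 2 * (Real.log n + Real.log (1 + L))) := by
    rw [← Real.log_mul hn0.ne' (by positivity), mul_comm ((d : ℝ) / 2), Real.exp_mul,
      Real.exp_log (by positivity)]
    gcongr
    linarith
  have h2 : (8 * Real.exp (|κ| * d + 1) * p) ^ p =
      Real.exp (p * (Real.log (8 * p) + |κ| * d + 1)) := by
    rw [mul_comm p, Real.exp_mul, add_assoc, Real.exp_add (Real.log (8 * p)),
      Real.exp_log (by positivity)]
    congr 1; ring
  have h3 : (4 : ℝ) ^ d = Real.exp (d * Real.log 4) := by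
    rw [mul_comm, Real.exp_mul, Real.exp_log (by norm_num), Real.rpow_natCast]
  have hlp : 0 ≤ Real.log (8 * p) := Real.log_nonneg (by linarith)
  have hl4 : 0 ≤ Real.log 4 := Real.log_nonneg (by norm_num)
  have hlL : 0 ≤ Real.log (1 + L) := Real.log_nonneg (by linarith)
  set A := 1 / 2 * Real.log (1 + L) + (5 / 4 + p) * |κ| + Real.log 4 with hA
  set B := p * (Real.log (8 * p) + 1) + 1 / 4 with hB
  have hA0 : 0 ≤ A := by positivity
  have hB0 : 0 ≤ B := by positivity
  have h4 : B ≤ B * d := le_mul_of_one_le_right hB0 hd1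
  -- The factor `2` comes from `log n ≥ 1/2`.
  have h5 : (A + B) * d ≤ 2 * (A + B) * (d * Real.log n) := by
    have h6 : 0 ≤ (A + B) * d := by positivity
    nlinarith
  rw [h2, h3]
  calc _ ≤ Real.exp ((d : ℝ) / 2 * (Real.log n + Real.log (1 + L))) * Real.exp (|κ| * d / 2) *
        (Real.exp (p * (Real.log (8 * p) + |κ| * d + 1)) * Real.exp (1 / 4) *
          (Real.exp (3 * (|κ| * d) / 4) * Real.exp (d * Real.log 4))) := by gcongr
    _ = Real.exp (1 / 2 * (d * Real.log n) + A * d + B) := by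
        simp only [← Real.exp_add]
        congr 1
        rw [hA, hB]; ring
    _ ≤ _ := by
        refine Real.exp_le_exp.2 ?_
        have h7 : entropyRate p L κ = 1 / 2 + 2 * (A + B) := by
          rw [entropyRate, hA, hB]; ring
        rw [h7]
        linarith

end Rate

/-! ### Decay of the affinity away from the true parameter -/

section Contraction

variable {q d n : ℕ} {U : EuclideanSpace ℝ (Fin q) → EuclideanSpace ℝ (Fin d) → ℝ}

/-- Outside a ball of radius a multiple of `ε_n`, the `n`-th power of the affinity is at most
`exp (-K d log n)`. -/
theorem hellingerAffinity_le_exp_of_far {b₁ b₂ L α CP g s K k : ℝ} (hb₁ : 0 < b₁) (hb₂ : 0 < b₂)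
    (hL : 0 < L) (hCP : 0 < CP) (hα : 1 ≤ α) (hU : IsLogConcaveModel U)
    (hP : UniformPoincare U CP) (hI : WassersteinIdentifiable U b₁ b₂ α)
    (hg : 0 < g) (hgCP : g ≤ Real.sqrt CP) (hK : 0 ≤ K) (hs : s = b₁ * L * g)
    (hk : k = 2 * (s + K / s) / L) (hε : 0 < epsilonN CP L α d n)
    (hεα : b₁ * epsilonN CP L α d n ^ α ≤ 1) {θ θs : EuclideanSpace ℝ (Fin d)}
    (hθ : max 1 (k / b₁) * Real.exp (k / (b₁ * b₂)) * epsilonN CP L α d n ≤ ‖θ - θs‖) :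
    hellingerAffinity U θ θs ≤ ENNReal.ofReal (Real.exp (-(K * ((d : ℝ) * Real.log n / n)))) := by
  have hs0 : 0 < s := by rw [hs]; positivity
  have hk0 : 0 ≤ k := by rw [hk]; positivity
  obtain ⟨m, Ψ, hΨ, hsep⟩ := hI.exists_separating hα hb₁ hb₂ hε hk0 hεα (le_max_left 1 (k / b₁))
    (le_max_right _ _)
  have h1 := hsep θ θs hθ
  rw [epsilonN_rpow hCP.le hL.le (by linarith)] at h1 hεα
  have hx : 0 ≤ (d : ℝ) * Real.log n / n := by positivity
  set x := (d : ℝ) * Real.log n / n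
  -- The choice `s = b₁ L g` with `g ≤ √CP` lets the hypothesis `b₁ ε_n^α ≤ 1` put `l` below in the
  -- admissible range `CP l² ≤ 1`.
  have hsx : s * Real.sqrt x ≤ 1 := by
    calc s * Real.sqrt x = b₁ * (g * L * Real.sqrt x) := by rw [hs]; ring
      _ ≤ b₁ * (Real.sqrt CP * L * Real.sqrt x) := by gcongr
      _ ≤ 1 := hεα
  have hsqCP : 0 < Real.sqrt CP := Real.sqrt_pos.2 hCP
  set l := s * Real.sqrt x / Real.sqrt CP with hl
  have hl0 : 0 ≤ l := by positivity
  have hl2 : CP * l ^ 2 = s ^ 2 * x := by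
    rw [hl, div_pow, mul_pow, Real.sq_sqrt hx, Real.sq_sqrt hCP.le]; field_simp
  have hl1 : CP * l ^ 2 ≤ 1 := by
    rw [hl2, ← Real.sq_sqrt hx, ← mul_pow]
    exact pow_le_one₀ (by positivity) hsx
  refine (hellingerAffinity_le hU hCP.le hP hΨ hl1 θ θs).trans ?_
  refine ENNReal.ofReal_le_ofReal (Real.exp_le_exp.2 ?_)
  have h2 := mul_le_mul_of_nonneg_left h1 hl0
  -- `k` is tuned so that half of this gain pays for `CP l² = s² x` and leaves `K x`.
  have h3 : l * (k * (Real.sqrt CP * L * Real.sqrt x)) = 2 * (s ^ 2 + K) * x := by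
    calc l * (k * (Real.sqrt CP * L * Real.sqrt x))
        = s * k * L * (Real.sqrt x) ^ 2 := by rw [hl]; field_simp
      _ = 2 * (s ^ 2 + K) * x := by rw [Real.sq_sqrt hx, hk]; field_simp
  rw [h3] at h2
  rw [hl2]
  linarith

end Contraction

/-! ### Choice of constants and conclusion -/

theorem mainTheorem1 (p : ℝ) (hp : 1 < p) (b₁ b₂ L κ : ℝ)
    (hb₁ : 0 < b₁) (hb₂ : 0 < b₂) (hL : 0 < L) :
    ∃ C : ℝ, 0 < C ∧
      ∀ (d q n : ℕ) (α CP : ℝ)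
        (U : EuclideanSpace ℝ (Fin q) → EuclideanSpace ℝ (Fin d) → ℝ)
        (V₀ : EuclideanSpace ℝ (Fin d) → ℝ) (θs : EuclideanSpace ℝ (Fin d)),
        2 ≤ n → 0 < α → 0 < CP →
        IsLogConcaveModel U → IsC11LogConcavePrior V₀ →
        UniformPoincare U CP → SmoothModel U L → WassersteinIdentifiable U b₁ b₂ α →
        V₀ θs ≤ κ * d →
        b₁ * epsilonN CP L α d n ^ α ≤ 1 →
        (∀ᵐ ξ ∂(dataLaw U θs n), PosteriorMeanExists U V₀ ξ) ∧
        posteriorMeanRisk U V₀ θs n p ≤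
          ENNReal.ofReal (C * (Real.sqrt CP * L) ^ (1 / α) *
            ((d : ℝ) * Real.log n / n) ^ (1 / (2 * α))) := by
  have hp0 : 0 < p := by linarith
  set g := b₁ / (2 + L) with hg
  have hg0 : 0 < g := by positivity
  set D := entropyRate p L κ with hD
  have hD0 : 0 ≤ D := by
    have hlp : 0 ≤ Real.log (8 * p) := Real.log_nonneg (by linarith)
    have hlL : 0 ≤ Real.log (1 + L) := Real.log_nonneg (by linarith)
    have hl4 : 0 ≤ Real.log 4 := Real.log_nonneg (by norm_num)
    rw [hD, entropyRate]
    positivity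
  set s := b₁ * L * g with hs
  have hs0 : 0 < s := by positivity
  -- Decay rate `D + p`: `D` cancels the growth of the constants and `p` leaves `n^(-p)`.
  set k := 2 * (s + (D + p) / s) / L with hk
  set R := max 1 (k / b₁) * Real.exp (k / (b₁ * b₂)) with hR
  have hR0 : 0 < R := by positivity
  set c := min 1 (g * L / 2) with hc
  have hc0 : 0 < c := by positivity
  refine ⟨R + 1 / c, by positivity, ?_⟩
  intro d q n α CP U V₀ θs hn hα hCP hU hV hP hS hI hκ hε
  refine ⟨ae_posteriorMeanExists hU hV hS hL.le θs, ?_⟩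
  rw [mul_assoc, rate_eq_epsilonN hCP.le hL.le]
  -- For `d = 0` the parameter space is a point; the lower bounds on `CP`, `α` and `ε_n` need `d >
  -- 0`.
  rcases Nat.eq_zero_or_pos d with hd | hd
  · subst hd
    have h0 : posteriorMeanRisk U V₀ θs n p = 0 := by
      have h1 : ∀ ξ : Fin n → EuclideanSpace ℝ (Fin q), posteriorMean U V₀ ξ - θs = 0 := fun ξ => Subsingleton.elim _ _
      simp [posteriorMeanRisk, h1, hp0]
    rw [h0]
    exact zero_le
  have hα1 := hI.one_le_exponent hU hS hCP hP hL hb₁ hb₂ hd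
  have hgCP := hI.le_sqrt hU hS hCP hP hL hb₂ hd
  have hεn := div_le_epsilonN hL hα1 hg0 hgCP hCP.le hd hn
  have hn0 : (0 : ℝ) < n := by positivity
  have hd1 : (1 : ℝ) ≤ d := by exact_mod_cast hd
  have hε0 : 0 < epsilonN CP L α d n := lt_of_lt_of_le (by positivity) hεn
  have hκ' : V₀ θs ≤ |κ| * d := hκ.trans (by gcongr; exact le_abs_self κ)
  have hmain := lintegral_posteriorMean_sub_rpow_le (n := n) hU hV hS hL.le hκ' hp.le
    (r := R * epsilonN CP L α d n) fun θ hθ =>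
      hellingerAffinity_le_exp_of_far (n := n) hb₁ hb₂ hL hCP hα1 hU hP hI hg0 hgCP
        (by positivity : 0 ≤ D + p) hs hk hε0 hε hθ
  set e := epsilonN CP L α d n
  have hconst := posterior_constant_le_exp (κ := κ) hp hL hd hn
  rw [← ENNReal.ofReal_pow (Real.exp_pos _).le, ← ENNReal.ofReal_mul (by positivity),
    ← ENNReal.ofReal_add (by positivity) (by positivity), ← Real.exp_nat_mul] at hmain
  have hlog : 0 ≤ Real.log n := by linarith [half_le_log_natCast hn]
  -- The far contribution is at most `n^(-p)`, and `1/n ≤ ε_n / c`.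
  have hsecond : Real.exp (D * (d * Real.log n)) *
      Real.exp (n * -((D + p) * ((d : ℝ) * Real.log n / n))) ≤ (1 / c * e) ^ p := by
    calc _ = Real.exp (-(p * (d * Real.log n))) := by
          rw [← Real.exp_add]; congr 1; field_simp; ring
      _ ≤ Real.exp (Real.log n * (-p)) := by
          refine Real.exp_le_exp.2 ?_
          have : p * (1 * Real.log n) ≤ p * (d * Real.log n) := by gcongr
          linarith
      _ = (1 / (n : ℝ)) ^ p := by
          rw [Real.exp_mul, Real.exp_log hn0, Real.rpow_neg hn0.le, one_div, Real.inv_rpow hn0.le]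
      _ ≤ _ := by
          gcongr
          rw [div_le_iff₀ hn0] at hεn ⊢
          rw [mul_assoc, one_div_mul_eq_div, le_div_iff₀ hc0]
          linarith
  have hfinal : ∫⁻ ξ, ‖posteriorMean U V₀ ξ - θs‖ₑ ^ p ∂(dataLaw U θs n) ≤
      ENNReal.ofReal ((R + 1 / c) * e) ^ p := by
    rw [ENNReal.ofReal_rpow_of_nonneg (by positivity) hp0.le]
    refine hmain.trans (ENNReal.ofReal_le_ofReal ?_)
    calc _ ≤ (R * e) ^ p + (1 / c * e) ^ p := by
          gcongr
          exact (mul_le_mul_of_nonneg_right hconst (Real.exp_pos _).le).trans hsecond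
      _ ≤ (R * e + 1 / c * e) ^ p := Real.add_rpow_le_rpow_add (by positivity) (by positivity) hp.le
      _ = _ := by rw [add_mul]
  rw [posteriorMeanRisk]
  refine (ENNReal.rpow_le_rpow hfinal (by positivity)).trans_eq ?_
  rw [← ENNReal.rpow_mul, mul_one_div_cancel hp0.ne', ENNReal.rpow_one]
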